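/- Let $\{\mathbb E^i;\rho^{ji}\}_{i\le j}$ be a projective sequence of real Banach spaces and continuous linear maps, with limit the Fréchet space $\mathbb F=\varprojlim\mathbb E^i$, and let $\{M^i;\varphi^{ji}\}_{i\le j}$ be a projective sequence of smooth ($C^\infty$) Banach manifolds $M^i$ modelled on $\mathbb E^i$ and smooth maps, with topological limit $M=\varprojlim M^i$. A *limit chart* of $M$ is $(U,\psi)=(\varprojlim U^i,\varprojlim\psi^i)$, where $(U^i,\psi^i)$ are charts of $M^i$ with $\varphi^{ji}(U^j)\subseteq U^i$ and $\psi^i\circ\varphi^{ji}=\rho^{ji}\circ\psi^j$ on $U^j$ for $i\le j$, such that $U$ is nonempty and open in $M$ and $\psi(U)=\varprojlim\psi^i(U^i)$ is open in $\mathbb F$. Assume that the limit charts cover $M$; $M$ is then regarded as a Fréchet manifold modelled on $\mathbb F$ through them (smoothness between Fréchet spaces is in the sense of Leslie). Let $T^2M=\bigcup_{x\in M}T^2_xM$, where $T^2_xM$ is the set of classes $[f,x]_2$ of smooth curves $f:(-\varepsilon,\varepsilon)\to M$ with $f(0)=x$, two curves being equivalent if they agree up to their acceleration, i.e. $(\psi\circ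 f)'(0)$ and $(\psi\circ f)''(0)$ agree in limit charts around $x$. Let $T_xM$ be the set of classes $[f,x]$ of the same curves modulo equality of $(\psi\circ f)'(0)$, and let $TM\times TM$ denote the bundle over $M$ with fibres $T_xM\times T_xM$, trivialized by $([f,x],[g,x])\mapsto(x,(\psi\circ f)'(0),(\psi\circ g)'(0))$ over limit charts. Let $$\mathcal H^0(\mathbb F\times\mathbb F)=\Big\{(l^i)\in\prod_i GL(\mathbb E^i\times\mathbb E^i):(\rho^{ji}\times\rho^{ji})\circ l^j=l^i\circ(\rho^{ji}\times\rho^{ji})\ \text{for } i\le j\Big\},$$ a group acting on $\mathbb F\times\mathbb F$ by $(l^i)\mapsto\varprojlim l^i$; maps into it are called smooth if they are smooth as maps into the Fréchet space $\mathcal H(\mathbb F\times\mathbb F)$ of all compatible sequences in $\prod_i\mathcal L(\mathbb E^i\times\mathbb E^i)$. A linear connection on $M^i$ is a map $D^i:T(TM^i)\to TM^i$ over $M^i$ which in every chart $(U,\psi)$ has the form $(y,u,v,w)\mapsto(y,w+\Gamma^i_\psi(y)(u)(v))$ with $\Gamma^i_\psi:\psi(U)\to\mathcal L(\mathbb E^i,\mathcal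 L(\mathbb E^i,\mathbb E^i))$ smooth. **Theorem.** Suppose that $M$ is endowed with a linear connection $D=\varprojlim D^i$, the limit of linear connections $D^i$ on $M^i$ with $T\varphi^{ji}\circ D^j=D^i\circ T(T\varphi^{ji})$ for $i\le j$. Then $T^2M$ is a Fréchet vector bundle over $M$ with fibres of type $\mathbb F\times\mathbb F$ and structural group $\mathcal H^0(\mathbb F\times\mathbb F)$: over every limit chart $(U,\psi)$ a local trivialization is $$[f,x]_2\longmapsto\big(x,\ (\psi\circ f)'(0),\ (\psi\circ f)''(0)+\Gamma_\psi(\psi(x))\big((\psi\circ f)'(0)\big)\big((\psi\circ f)'(0)\big)\big),\qquad \Gamma_\psi=\varprojlim\Gamma^i_{\psi^i},$$ these trivializations make $T^2M$ a Fréchet manifold, and their transition functions are given by a smooth cocycle with values in $\mathcal H^0(\mathbb F\times\mathbb F)$. Moreover, $TM\times TM$ is also a Fréchet vector bundle over $M$ with structural group $\mathcal H^0(\mathbb F\times\mathbb F)$, and $T^2M$ is isomorphic to $TM\times TM$ as such a bundle. -/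

import Mathlib

open Set Filter Topology
open scoped Manifold ContDiff

universe u v

noncomputable section

namespace FrechetT2

/-! ## Differential calculus in topological vector spaces (in the sense of Leslie) -/

section Calculus

variable {X : Type u} [AddCommGroup X] [Module ℝ X] [TopologicalSpace X]
variable {Y : Type v} [AddCommGroup Y] [Module ℝ Y] [TopologicalSpace Y]

/-- `f` is differentiable at `x` with differential `f'`: the remainder
`R (t, v) = (f (x + t v) - f x - f' (t v)) / t` for `t ≠ 0`, `R (0, v) = 0`, is continuous at every
point `(0, v)` of `ℝ × X`.  (In Lean `0⁻¹ • _ = 0`, so one formula covers both cases.) -/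
def HasLeslieDerivAt (f : X → Y) (f' : X →L[ℝ] Y) (x : X) : Prop :=
  ∀ v : X, ContinuousAt
    (fun p : ℝ × X => p.1⁻¹ • (f (x + p.1 • p.2) - f x - f' (p.1 • p.2))) (0, v)

end Calculus

/-- `f` is of class `C^n` on `U` (used for open `U`): `C^0` means continuous, and `C^(n+1)` means
continuous and differentiable at all points of `U`, with `(x, v) ↦ Df(x) v` of class `C^n` on
`U × X`. -/
def LeslieC {Y : Type v} [AddCommGroup Y] [Module ℝ Y] [TopologicalSpace Y] :
    ℕ → ∀ (X : Type u) [AddCommGroup X] [Module ℝ X] [TopologicalSpace X],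
      (X → Y) → Set X → Prop
  | 0 => fun _ _ _ _ f U => ContinuousOn f U
  | n + 1 => fun X _ _ _ f U => ContinuousOn f U ∧
      ∃ f' : X → X →L[ℝ] Y, (∀ x ∈ U, HasLeslieDerivAt f (f' x) x) ∧
        LeslieC n (X × X) (fun p : X × X => f' p.1 p.2) (U ×ˢ univ)

/-- `f` is smooth (of class `C^n` for all `n`) on `U`. -/
def LeslieSmoothOn {X : Type u} [AddCommGroup X] [Module ℝ X] [TopologicalSpace X]
    {Y : Type v} [AddCommGroup Y] [Module ℝ Y] [TopologicalSpace Y]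
    (f : X → Y) (U : Set X) : Prop :=
  ∀ n : ℕ, LeslieC n X f U

/-- The derivative `c'(t) = lim_{h → 0} (c (t + h) - c t) / h` of a curve in a topological vector
space (only used where this limit exists). -/
def curveDeriv {Y : Type v} [AddCommGroup Y] [Module ℝ Y] [TopologicalSpace Y]
    (c : ℝ → Y) (t : ℝ) : Y :=
  limUnder (𝓝[≠] (0 : ℝ)) (fun h => h⁻¹ • (c (t + h) - c t))

/-! ## Smooth atlases modelled on topological vector spaces -/

section Atlases

variable {F : Type u} [AddCommGroup F] [Module ℝ F] [TopologicalSpace F]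
variable {G : Type v} [AddCommGroup G] [Module ℝ G] [TopologicalSpace G]

/-- A family of charts of `X` with values in `F` is a smooth atlas: the domains cover `X` and the
changes of charts are smooth. -/
structure IsSmoothAtlas {X : Type*} [TopologicalSpace X]
    (A : Set (OpenPartialHomeomorph X F)) : Prop where
  cover : ∀ x : X, ∃ e ∈ A, x ∈ e.source
  compat : ∀ e ∈ A, ∀ e' ∈ A, LeslieSmoothOn (e' ∘ e.symm) (e.symm.trans e').source

/-- The map `f` is smooth on the open set `s`, with respect to atlases of source and target. -/
def SmoothMapOn {X : Type*} [TopologicalSpace X] {Y : Type*} [TopologicalSpace Y]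
    (A : Set (OpenPartialHomeomorph X F)) (B : Set (OpenPartialHomeomorph Y G))
    (f : X → Y) (s : Set X) : Prop :=
  ContinuousOn f s ∧ ∀ e ∈ A, ∀ e' ∈ B,
    LeslieSmoothOn (e' ∘ f ∘ e.symm) (e.target ∩ e.symm ⁻¹' (s ∩ f ⁻¹' e'.source))

/-- The standard atlas (the identity chart) of a topological vector space. -/
def vectorAtlas (F : Type u) [TopologicalSpace F] : Set (OpenPartialHomeomorph F F) :=
  {OpenPartialHomeomorph.refl F}

end Atlases

/-! ## Linear connections on Banach manifolds (in the sense of Vilms) -/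

section Connections

variable {E : Type u} [NormedAddCommGroup E] [NormedSpace ℝ E]
variable {N : Type v} [TopologicalSpace N] [ChartedSpace E N] [IsManifold 𝓘(ℝ, E) ∞ N]

/-- The local coordinates `(y, u)` on the tangent bundle `TN` induced by a chart `e` of `N`. -/
def tangentCoord (e : OpenPartialHomeomorph N E) (p : TangentBundle 𝓘(ℝ, E) N) : E × E :=
  (e p.proj, mfderiv 𝓘(ℝ, E) 𝓘(ℝ, E) e p.proj p.2)

/-- The local coordinates `((y, u), (v, w))` on `T(TN)` induced by a chart `e` of `N`. -/
def tangentTwoCoord (e : OpenPartialHomeomorph N E)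
    (ξ : TangentBundle 𝓘(ℝ, E).tangent (TangentBundle 𝓘(ℝ, E) N)) : (E × E) × (E × E) :=
  (tangentCoord e ξ.proj,
    mfderiv 𝓘(ℝ, E).tangent 𝓘(ℝ, E × E) (tangentCoord (N := N) e) ξ.proj ξ.2)

variable (E N) in
/-- A linear connection on `N`: a map `D : T(TN) → TN` over `N` which in every chart `e` has the
form `D (y, u, v, w) = (y, w + Γ_e(y)(u)(v))` with smooth Christoffel symbols
`Γ_e : e(U) → L(E, L(E, E))`.  (This local form makes `D` a smooth vector bundle morphism, and it
determines `Γ_e` on `e(U)`.) -/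
structure LinearConnection where
  D : TangentBundle 𝓘(ℝ, E).tangent (TangentBundle 𝓘(ℝ, E) N) → TangentBundle 𝓘(ℝ, E) N
  christoffel : OpenPartialHomeomorph N E → E → E →L[ℝ] E →L[ℝ] E
  proj_D : ∀ ξ, (D ξ).proj = ξ.proj.proj
  christoffel_smooth : ∀ e ∈ IsManifold.maximalAtlas 𝓘(ℝ, E) ∞ N,
    ContDiffOn ℝ ∞ (christoffel e) e.target
  local_form : ∀ e ∈ IsManifold.maximalAtlas 𝓘(ℝ, E) ∞ N, ∀ ξ, ξ.proj.proj ∈ e.source →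
    ∀ y u v w : E, tangentTwoCoord e ξ = ((y, u), (v, w)) →
      tangentCoord e (D ξ) = (y, w + christoffel e y u v)

end Connections

/-! ## Projective systems of Banach manifolds and their limits -/

variable (E : ℕ → Type u) [∀ i, NormedAddCommGroup (E i)] [∀ i, NormedSpace ℝ (E i)]
variable (M : ℕ → Type v) [∀ i, TopologicalSpace (M i)] [∀ i, ChartedSpace (E i) (M i)]

/-- A projective system of smooth manifolds `M i` modelled on the spaces `E i`, which form a
projective system themselves. -/
structure ProjSystem where
  ρ : ∀ {i j : ℕ}, i ≤ j → (E j →L[ℝ] E i)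
  ρ_refl : ∀ i, ρ (le_refl i) = ContinuousLinearMap.id ℝ (E i)
  ρ_comp : ∀ {i j k : ℕ} (hij : i ≤ j) (hjk : j ≤ k), (ρ hij).comp (ρ hjk) = ρ (hij.trans hjk)
  φ : ∀ {i j : ℕ}, i ≤ j → M j → M i
  φ_smooth : ∀ {i j : ℕ} (hij : i ≤ j), ContMDiff 𝓘(ℝ, E j) 𝓘(ℝ, E i) ∞ (φ hij)
  φ_refl : ∀ i, φ (le_refl i) = id
  φ_comp : ∀ {i j k : ℕ} (hij : i ≤ j) (hjk : j ≤ k), φ hij ∘ φ hjk = φ (hij.trans hjk)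

variable {E M}

namespace ProjSystem

variable (S : ProjSystem E M)

/-- The Fréchet space `𝔽 = lim E i`, with the topology induced by the product. -/
def Model : Submodule ℝ (∀ i, E i) where
  carrier := {x | ∀ (i j : ℕ) (h : i ≤ j), S.ρ h (x j) = x i}
  add_mem' hx hy i j h := by simp [hx i j h, hy i j h]
  zero_mem' i j h := by simp
  smul_mem' c x hx i j h := by simp [hx i j h]

/-- The limit `M = lim M i`, with the topology induced by the product. -/
abbrev Lim : Type v := {x : ∀ i, M i // ∀ (i j : ℕ) (h : i ≤ j), S.φ h (x j) = x i}

/-- A projective system of local charts `(U i, ψ i)` of the manifolds `M i` whose limit is a chart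
of `M` with values in `𝔽`: `lim U i` is a nonempty open subset of `M`, and `lim ψ i (U i)` is open
in `𝔽`. -/
structure LimitChart where
  chart : ∀ i, OpenPartialHomeomorph (M i) (E i)
  mem_maximalAtlas : ∀ i, chart i ∈ IsManifold.maximalAtlas 𝓘(ℝ, E i) ∞ (M i)
  map_source : ∀ (i j : ℕ) (h : i ≤ j), ∀ x ∈ (chart j).source, S.φ h x ∈ (chart i).source
  comm : ∀ (i j : ℕ) (h : i ≤ j), ∀ x ∈ (chart j).source,
    chart i (S.φ h x) = S.ρ h (chart j x)
  nonempty_source : {x : S.Lim | ∀ i, x.1 i ∈ (chart i).source}.Nonempty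
  isOpen_source : IsOpen {x : S.Lim | ∀ i, x.1 i ∈ (chart i).source}
  isOpen_target : IsOpen {y : S.Model | ∀ i, y.1 i ∈ (chart i).target}

namespace LimitChart

variable {S} (c : S.LimitChart)

lemma map_mem {x : S.Lim} (hx : ∀ i, x.1 i ∈ (c.chart i).source) :
    (fun i => c.chart i (x.1 i)) ∈ S.Model := by
  intro i j h
  have := c.comm i j h (x.1 j) (hx j)
  rw [x.2 i j h] at this
  exact this.symm

lemma symm_compat {y : S.Model} (hy : ∀ i, y.1 i ∈ (c.chart i).target) (i j : ℕ) (h : i ≤ j) :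
    S.φ h ((c.chart j).symm (y.1 j)) = (c.chart i).symm (y.1 i) := by
  have hs := (c.chart j).map_target (hy j)
  have h1 := c.comm i j h _ hs
  rw [(c.chart j).right_inv (hy j), y.2 i j h] at h1
  rw [← h1, (c.chart i).left_inv (c.map_source i j h _ hs)]

open Classical in
/-- The chart `lim ψ i : lim U i → lim ψ i (U i) ⊆ 𝔽` of `M`. -/
def toChart : OpenPartialHomeomorph S.Lim S.Model where
  toFun x := if h : ∀ i, x.1 i ∈ (c.chart i).source then ⟨_, c.map_mem h⟩ else 0
  invFun y := if h : ∀ i, y.1 i ∈ (c.chart i).target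
    then ⟨fun i => (c.chart i).symm (y.1 i), c.symm_compat h⟩ else c.nonempty_source.some
  source := {x | ∀ i, x.1 i ∈ (c.chart i).source}
  target := {y | ∀ i, y.1 i ∈ (c.chart i).target}
  map_source' x hx i := by
    rw [Set.mem_ofPred_eq] at hx
    rw [dif_pos hx]
    exact (c.chart i).map_source (hx i)
  map_target' y hy i := by
    rw [Set.mem_ofPred_eq] at hy
    rw [dif_pos hy]
    exact (c.chart i).map_target (hy i)
  left_inv' x hx := by
    rw [Set.mem_ofPred_eq] at hx
    rw [dif_pos hx, dif_pos (fun i => (c.chart i).map_source (hx i))]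
    exact Subtype.ext (funext fun i => (c.chart i).left_inv (hx i))
  right_inv' y hy := by
    rw [Set.mem_ofPred_eq] at hy
    rw [dif_pos hy, dif_pos (fun i => (c.chart i).map_target (hy i))]
    exact Subtype.ext (funext fun i => (c.chart i).right_inv (hy i))
  open_source := c.isOpen_source
  open_target := c.isOpen_target
  continuousOn_toFun := by
    rw [Topology.IsInducing.subtypeVal.continuousOn_iff, continuousOn_pi]
    intro i
    refine ContinuousOn.congr (f := fun x : S.Lim => c.chart i (x.1 i)) ?_ ?_
    · exact (c.chart i).continuousOn.comp
        ((continuous_apply i).comp continuous_subtype_val).continuousOn (fun x hx => hx i)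
    · intro x hx
      rw [Set.mem_ofPred_eq] at hx
      simp only [Function.comp_apply]
      rw [dif_pos hx]
  continuousOn_invFun := by
    refine Topology.IsInducing.subtypeVal.continuousOn_iff.2 (continuousOn_pi.2 ?_)
    intro i
    refine ContinuousOn.congr (f := fun y : S.Model => (c.chart i).symm (y.1 i)) ?_ ?_
    · exact (c.chart i).continuousOn_symm.comp
        ((continuous_apply i).comp continuous_subtype_val).continuousOn (fun x hx => hx i)
    · intro x hx
      rw [Set.mem_ofPred_eq] at hx
      simp only [Function.comp_apply]
      rw [dif_pos hx]

end LimitChart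

/-- The atlas of `M` consisting of all limits of projective systems of charts. -/
def limitAtlas : Set (OpenPartialHomeomorph S.Lim S.Model) :=
  range (LimitChart.toChart (S := S))

/-! ### Tangent bundles of order one and two of the limit -/

/-- Smooth curves `f : (-ε, ε) → M`, `ε > 0`, with `f 0 = x`.  (Values outside of the interval are
irrelevant: all equivalence relations below only depend on the germ of `f` at `0`.) -/
def Curve (x : S.Lim) : Type v :=
  {f : ℝ → S.Lim // f 0 = x ∧
    ∃ ε > 0, SmoothMapOn (vectorAtlas ℝ) S.limitAtlas f (Ioo (-ε) ε)}

variable {S}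

/-- The velocity `(ψ ∘ f)'(0)` of a curve in a limit chart. -/
def Curve.vel {x : S.Lim} (f : S.Curve x) (c : S.LimitChart) : S.Model :=
  curveDeriv (c.toChart ∘ f.1) 0

/-- The acceleration `(ψ ∘ f)''(0)` of a curve in a limit chart. -/
def Curve.acc {x : S.Lim} (f : S.Curve x) (c : S.LimitChart) : S.Model :=
  curveDeriv (curveDeriv (c.toChart ∘ f.1)) 0

variable (S)

/-- Curves through `x` with the same velocity: `f'(0) = g'(0)` in `TM`. -/
def velSetoid (x : S.Lim) : Setoid (S.Curve x) where
  r f g := ∀ c : S.LimitChart, x ∈ c.toChart.source → f.vel c = g.vel c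
  iseqv := ⟨fun _ _ _ => rfl, fun h c hc => (h c hc).symm,
    fun h h' c hc => (h c hc).trans (h' c hc)⟩

/-- Curves through `x` which agree up to their acceleration: `f'(0) = g'(0)` in `TM` and
`f''(0) = g''(0)` in `T(TM)`, that is, both derivatives agree in the charts around `x`. -/
def accSetoid (x : S.Lim) : Setoid (S.Curve x) where
  r f g := ∀ c : S.LimitChart, x ∈ c.toChart.source → f.vel c = g.vel c ∧ f.acc c = g.acc c
  iseqv := ⟨fun _ _ _ => ⟨rfl, rfl⟩, fun h c hc => ⟨(h c hc).1.symm, (h c hc).2.symm⟩,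
    fun h h' c hc => ⟨(h c hc).1.trans (h' c hc).1, (h c hc).2.trans (h' c hc).2⟩⟩

/-- The tangent space of `M` at `x`. -/
def TangentSp (x : S.Lim) : Type v := Quotient (S.velSetoid x)

/-- The tangent space of order two of `M` at `x`. -/
def TangentSp2 (x : S.Lim) : Type v := Quotient (S.accSetoid x)

/-- The tangent bundle of order two `T²M` (as a set). -/
def T2M : Type v := Σ x : S.Lim, S.TangentSp2 x

/-- The projection `T²M → M`. -/
def T2M.proj (p : S.T2M) : S.Lim := p.1

/-- The bundle `TM × TM` over `M` (as a set), with fibres `T_xM × T_xM`. -/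
def TMTM : Type v := Σ x : S.Lim, S.TangentSp x × S.TangentSp x

/-- The projection `TM × TM → M`. -/
def TMTM.proj (p : S.TMTM) : S.Lim := p.1

variable {S}

/-- The class `[f, x]₂` in `T²M`. -/
def T2M.mk {x : S.Lim} (f : S.Curve x) : S.T2M := ⟨x, Quotient.mk (S.accSetoid x) f⟩

/-- The pair `([f, x], [g, x])` in `TM × TM`. -/
def TMTM.mk {x : S.Lim} (f g : S.Curve x) : S.TMTM :=
  ⟨x, Quotient.mk (S.velSetoid x) f, Quotient.mk (S.velSetoid x) g⟩

variable (S)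

/-! ### The group `H⁰(𝔽 × 𝔽)` and vector bundles with this structural group -/

/-- The Fréchet space `H(𝔽 × 𝔽)` of all sequences `(l i)` of continuous linear operators on
`E i × E i` that are compatible with the connecting maps, so that `lim l i` exists; the topology is
induced by the product of the operator norm topologies. -/
def H : Submodule ℝ (∀ i, (E i × E i) →L[ℝ] (E i × E i)) where
  carrier := {l | ∀ (i j : ℕ) (h : i ≤ j),
    ((S.ρ h).prodMap (S.ρ h)).comp (l j) = (l i).comp ((S.ρ h).prodMap (S.ρ h))}
  add_mem' hx hy i j h := by
    simp only [Pi.add_apply, ContinuousLinearMap.comp_add, ContinuousLinearMap.add_comp,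
      hx i j h, hy i j h]
  zero_mem' i j h := by simp
  smul_mem' c x hx i j h := by
    simp only [Pi.smul_apply, ContinuousLinearMap.comp_smul, ContinuousLinearMap.smul_comp,
      hx i j h]

/-- The group `H⁰(𝔽 × 𝔽)`: all `(l i) ∈ ∏ GL(E i × E i)` such that `lim l i` exists.  (As a
subgroup of a product of the topological groups `GL(E i × E i)` it is a topological group.) -/
def H0 : Subgroup (∀ i, ((E i × E i) →L[ℝ] (E i × E i))ˣ) where
  carrier := {l | (fun i => (l i : (E i × E i) →L[ℝ] (E i × E i))) ∈ S.H}
  one_mem' i j h := by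
    simp [ContinuousLinearMap.one_def]
  mul_mem' {a b} ha hb i j h := by
    have h1 := ha i j h
    have h2 := hb i j h
    simp only [Pi.mul_apply, Units.val_mul, ContinuousLinearMap.mul_def] at *
    rw [← ContinuousLinearMap.comp_assoc, h1, ContinuousLinearMap.comp_assoc, h2,
      ContinuousLinearMap.comp_assoc]
  inv_mem' {a} ha i j h := by
    have h1 := ha i j h
    simp only [Pi.inv_apply] at *
    have e1 : ((a j : (E j × E j) →L[ℝ] (E j × E j))).comp
        ((a j)⁻¹ : ((E j × E j) →L[ℝ] (E j × E j))ˣ).1 = ContinuousLinearMap.id ℝ _ :=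
      (a j).mul_inv
    have e2 : (((a i)⁻¹ : ((E i × E i) →L[ℝ] (E i × E i))ˣ).1).comp
        (a i : (E i × E i) →L[ℝ] (E i × E i)) = ContinuousLinearMap.id ℝ _ :=
      (a i).inv_mul
    have h2 := congrArg (fun T => (((a i)⁻¹ : ((E i × E i) →L[ℝ] (E i × E i))ˣ).1).comp
      (T.comp ((a j)⁻¹ : ((E j × E j) →L[ℝ] (E j × E j))ˣ).1)) h1
    simp only [ContinuousLinearMap.comp_assoc, e1] at h2
    rw [← ContinuousLinearMap.comp_assoc, ← ContinuousLinearMap.comp_assoc, e2,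
      ContinuousLinearMap.id_comp, ContinuousLinearMap.comp_id] at h2
    exact h2.symm

variable {S}

/-- The inclusion of `H⁰(𝔽 × 𝔽)` in the Fréchet space `H(𝔽 × 𝔽)`. -/
def H0toH (l : S.H0) : S.H := ⟨fun i => (l.1 i : (E i × E i) →L[ℝ] (E i × E i)), l.2⟩

lemma H.apply_compat (l : S.H) (p : S.Model × S.Model) (i j : ℕ) (h : i ≤ j) :
    (S.ρ h (l.1 j (p.1.1 j, p.2.1 j)).1, S.ρ h (l.1 j (p.1.1 j, p.2.1 j)).2)
      = l.1 i (p.1.1 i, p.2.1 i) := by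
  have := congrArg (fun T => T (p.1.1 j, p.2.1 j)) (l.2 i j h)
  simpa [p.1.2 i j h, p.2.2 i j h, Prod.map] using this

/-- The operator `lim l i` on `𝔽 × 𝔽`. -/
def H.lim (l : S.H) : (S.Model × S.Model) →L[ℝ] (S.Model × S.Model) where
  toFun p := (⟨fun i => (l.1 i (p.1.1 i, p.2.1 i)).1,
      fun i j h => congrArg Prod.fst (H.apply_compat l p i j h)⟩,
    ⟨fun i => (l.1 i (p.1.1 i, p.2.1 i)).2,
      fun i j h => congrArg Prod.snd (H.apply_compat l p i j h)⟩)
  map_add' p q := by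
    have (i : ℕ) : l.1 i ((p + q).1.1 i, (p + q).2.1 i)
        = l.1 i (p.1.1 i, p.2.1 i) + l.1 i (q.1.1 i, q.2.1 i) := by
      rw [← map_add]; rfl
    ext i
    · exact congrArg Prod.fst (this i)
    · exact congrArg Prod.snd (this i)
  map_smul' a p := by
    have (i : ℕ) : l.1 i ((a • p).1.1 i, (a • p).2.1 i) = a • l.1 i (p.1.1 i, p.2.1 i) := by
      rw [← map_smul]; rfl
    ext i
    · exact congrArg Prod.fst (this i)
    · exact congrArg Prod.snd (this i)
  cont := by
    have (i : ℕ) : Continuous fun p : S.Model × S.Model => l.1 i (p.1.1 i, p.2.1 i) :=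
      (l.1 i).continuous.comp
        (((continuous_apply i).comp (continuous_subtype_val.comp continuous_fst)).prodMk
          ((continuous_apply i).comp (continuous_subtype_val.comp continuous_snd)))
    exact (Continuous.subtype_mk (continuous_pi fun i => (this i).fst) _).prodMk
      (Continuous.subtype_mk (continuous_pi fun i => (this i).snd) _)

/-- The homomorphism `ε : H⁰(𝔽 × 𝔽) → L(𝔽 × 𝔽)`, `(l i) ↦ lim l i`. -/
def limOp (l : S.H0) : (S.Model × S.Model) →L[ℝ] (S.Model × S.Model) := H.lim (H0toH l)

variable (S)

/-- Smoothness of a map from an open subset of `M` to `H⁰(𝔽 × 𝔽)`, as a map to the Fréchet space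
`H(𝔽 × 𝔽)`. -/
def SmoothH0On (T : S.Lim → S.H0) (s : Set S.Lim) : Prop :=
  SmoothMapOn S.limitAtlas (vectorAtlas S.H) (fun x => H0toH (T x)) s

/-- The charts of the total space given by local trivializations and the charts of `M`. -/
def totalAtlas {ι : Type*} {X : Type*} [TopologicalSpace X] {π : X → S.Lim}
    (triv : ι → Bundle.Trivialization (S.Model × S.Model) π) :
    Set (OpenPartialHomeomorph X (S.Model × (S.Model × S.Model))) :=
  {e | ∃ α : ι, ∃ b ∈ S.limitAtlas, e = (triv α).toOpenPartialHomeomorph.trans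
    (b.prod (OpenPartialHomeomorph.refl (S.Model × S.Model)))}

/-- A Fréchet vector bundle structure on `π : X → M`, with fibres of type `𝔽 × 𝔽` and structural
group `H⁰(𝔽 × 𝔽)`: local trivializations over a covering of `M`, whose transition functions
are given by a smooth cocycle with values in `H⁰(𝔽 × 𝔽)`.  The base is a Fréchet manifold, and the
trivializations make the total space a Fréchet manifold; every fibre is a topological vector space
through the trivializations. -/
structure H0VectorBundle (ι : Type*) {X : Type*} [TopologicalSpace X] (π : X → S.Lim) where
  triv : ι → Bundle.Trivialization (S.Model × S.Model) π
  cover : ∀ x : S.Lim, ∃ α, x ∈ (triv α).baseSet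
  base_atlas : IsSmoothAtlas S.limitAtlas
  total_atlas : IsSmoothAtlas (S.totalAtlas triv)
  trans : ι → ι → S.Lim → S.H0
  trans_smooth : ∀ α β, S.SmoothH0On (trans α β) ((triv α).baseSet ∩ (triv β).baseSet)
  trans_spec : ∀ α β, ∀ x ∈ (triv α).baseSet ∩ (triv β).baseSet, ∀ v : S.Model × S.Model,
    triv α ((triv β).toOpenPartialHomeomorph.symm (x, v)) = (x, limOp (trans α β x) v)
  cocycle : ∀ α β γ, ∀ x ∈ (triv α).baseSet ∩ (triv β).baseSet ∩ (triv γ).baseSet,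
    trans α β x * trans β γ x = trans α γ x

/-- An isomorphism of vector bundles with structural group `H⁰(𝔽 × 𝔽)` over `M`: a
diffeomorphism over `M` which, in the trivializations, is given by smooth `H⁰(𝔽 × 𝔽)`-valued
functions that are compatible with the cocycles of both bundles. -/
structure H0VectorBundleIso {ι κ : Type*} {X Y : Type*} [TopologicalSpace X] [TopologicalSpace Y]
    {π : X → S.Lim} {π' : Y → S.Lim}
    (B : S.H0VectorBundle ι π) (B' : S.H0VectorBundle κ π') where
  toEquiv : X ≃ Y
  proj_comp : ∀ p, π' (toEquiv p) = π p
  smooth : SmoothMapOn (S.totalAtlas B.triv) (S.totalAtlas B'.triv) toEquiv univ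
  smooth_symm : SmoothMapOn (S.totalAtlas B'.triv) (S.totalAtlas B.triv) toEquiv.symm univ
  rep : κ → ι → S.Lim → S.H0
  rep_smooth : ∀ α β, S.SmoothH0On (rep α β) ((B'.triv α).baseSet ∩ (B.triv β).baseSet)
  rep_spec : ∀ α β, ∀ x ∈ (B'.triv α).baseSet ∩ (B.triv β).baseSet, ∀ v : S.Model × S.Model,
    B'.triv α (toEquiv ((B.triv β).toOpenPartialHomeomorph.symm (x, v)))
      = (x, limOp (rep α β x) v)
  rep_trans : ∀ α β γ, ∀ x ∈ (B'.triv α).baseSet ∩ (B.triv β).baseSet ∩ (B.triv γ).baseSet,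
    rep α β x * B.trans β γ x = rep α γ x
  trans_rep : ∀ α β γ, ∀ x ∈ (B'.triv α).baseSet ∩ (B'.triv β).baseSet ∩ (B.triv γ).baseSet,
    B'.trans α β x * rep β γ x = rep α γ x

/-- A linear connection `D = lim D i` on `M`: linear connections `D i` on the `M i` which commute
with the tangent maps of the connecting maps, `Tφ ∘ D j = D i ∘ T(Tφ)`. -/
structure LimitConnection [∀ i, IsManifold 𝓘(ℝ, E i) ∞ (M i)] where
  conn : ∀ i, LinearConnection (E i) (M i)
  compat : ∀ (i j : ℕ) (h : i ≤ j) ξ,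
    tangentMap 𝓘(ℝ, E j) 𝓘(ℝ, E i) (S.φ h) ((conn j).D ξ)
      = (conn i).D (tangentMap 𝓘(ℝ, E j).tangent 𝓘(ℝ, E i).tangent
          (tangentMap 𝓘(ℝ, E j) 𝓘(ℝ, E i) (S.φ h)) ξ)

end ProjSystem

end FrechetT2

end

noncomputable section

namespace FrechetT2

/-! ### Differential calculus on limits of Banach spaces -/

section LeslieCalculus

universe u₁ u₂

/-! Under a change of charts τ the velocity v of a curve becomes Dτ(v), but its acceleration a
becomes Dτ(a) + D²τ(v)(v), so accelerations alone do not transform linearly. The Christoffel symbols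
have the opposite defect: Γ'(Dτ u)(Dτ v) + D²τ(v)(u) = Dτ(Γ(u)(v))
(`LinearConnection.christoffel_chart_change`). Hence a + Γ(v)(v) transforms by Dτ alone
(`limOp_transCocycle_acc`). Thus T²M in the coordinates (v, a + Γ(v)(v)) and TM × TM in pairs of
velocities have one and the same cocycle Dτ × Dτ, called `transCocycle`. Both are realizations of
the bundle `cocycleCore` glued from it; their bundle structures and the isomorphism between them are
obtained by transport.

The passage to the limit rests on one principle, `leslieC_of_levels`. The spaces 𝔽 and H(𝔽 × 𝔽) are
closed in products of Banach spaces, and a map into such a space whose i-th component is a smooth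
Banach map of the i-th coordinate is Leslie smooth: the levelwise derivatives are limits of
difference quotients, so closedness keeps them inside the space. All chart changes, transition
functions and test curves have this levelwise form, so only Banach calculus is needed.

Three facts make the levels fit together. Differentiating ρ ∘ τʲ = τⁱ ∘ ρ puts the cocycle in H⁰
(`chartChangeDeriv_compat`); connections related by φ have Christoffel symbols related by ρ, so Γ
has a limit (`LinearConnection.christoffel_related`); and parabolas in a limit chart realize every
velocity and acceleration, so the fibre coordinates are bijective (`exists_curve`). -/

theorem tendsto_slope_of_hasLeslieDerivAt
    {X : Type*} [AddCommGroup X] [Module ℝ X] [TopologicalSpace X]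
    {Y : Type*} [AddCommGroup Y] [Module ℝ Y] [TopologicalSpace Y] [ContinuousAdd Y]
    {f : X → Y} {f' : X →L[ℝ] Y} {x : X} (h : HasLeslieDerivAt f f' x) (v : X) :
    Tendsto (fun t : ℝ => t⁻¹ • (f (x + t • v) - f x)) (𝓝[≠] 0) (𝓝 (f' v)) := by
  have h1 : Tendsto (fun t : ℝ => ((t, v) : ℝ × X)) (𝓝[≠] 0) (𝓝 (0, v)) :=
    (((continuous_id.prodMk continuous_const).tendsto' (0 : ℝ) ((0 : ℝ), v) rfl)).mono_left
      nhdsWithin_le_nhds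
  have h2 := ((h v).tendsto.comp h1).add_const (f' v)
  simp only [inv_zero, zero_smul, zero_add] at h2
  refine h2.congr' ?_
  filter_upwards [self_mem_nhdsWithin] with t ht
  have ht : t ≠ 0 := ht
  simp [smul_sub, smul_smul, ht]

/-- The Fréchet remainder is o(t • w), and w stays bounded near b, so it is o(t) jointly in (t, w);
dividing by t gives the limit 0. -/
theorem hasLeslieDerivAt_of_hasFDerivAt {A B : Type*} [NormedAddCommGroup A] [NormedSpace ℝ A]
    [NormedAddCommGroup B] [NormedSpace ℝ B] {g : A → B} {g' : A →L[ℝ] B} {a : A}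
    (h : HasFDerivAt g g' a) : HasLeslieDerivAt g g' a := by
  intro b
  have hlim : Tendsto (fun z : ℝ × A => a + z.1 • z.2) (𝓝 (0, b)) (𝓝 a) := by
    refine Continuous.tendsto' (by fun_prop) _ _ (by simp)
  have h1 := h.isLittleO.comp_tendsto hlim
  have hO : (fun z : ℝ × A => z.1 • z.2) =O[𝓝 (0, b)] fun z => z.1 := by
    have hb : (fun z : ℝ × A => z.2) =O[𝓝 (0, b)] fun _ => (1 : ℝ) :=
      continuous_snd.continuousAt.isBigO_one ℝ
    simpa using (Asymptotics.isBigO_refl (fun z : ℝ × A => z.1) (𝓝 (0, b))).smul hb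
  have h2 : (fun z : ℝ × A => g (a + z.1 • z.2) - g a - g' (z.1 • z.2)) =o[𝓝 (0, b)]
      fun z => z.1 := by
    refine Asymptotics.IsLittleO.trans_isBigO (g := fun z : ℝ × A => z.1 • z.2) ?_ hO
    simpa [Function.comp_def] using h1
  have h3 := h2.tendsto_inv_smul_nhds_zero
  simpa [ContinuousAt] using h3

variable {ι : Type*} {Y : Type u₁} [AddCommGroup Y] [Module ℝ Y] [TopologicalSpace Y]
  {B : ι → Type*} [∀ i, NormedAddCommGroup (B i)] [∀ i, NormedSpace ℝ (B i)]
  {q : ∀ i, Y →L[ℝ] B i}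

/-- The derivative of a map that is given by `C^1` maps `g i` between normed spaces exists as the
limit of the derivatives of the `g i`. -/
theorem exists_limit_fderiv (hq : IsClosedEmbedding (fun (y : Y) i => q i y))
    {X : Type*} [AddCommGroup X] [Module ℝ X] [TopologicalSpace X] [ContinuousAdd X]
    [ContinuousSMul ℝ X]
    {A : ι → Type*} [∀ i, NormedAddCommGroup (A i)] [∀ i, NormedSpace ℝ (A i)]
    {p : ∀ i, X →L[ℝ] A i} {G : X → Y} {U : Set X} (hU : IsOpen U)
    {g : ∀ i, A i → B i} {x : X} (hx : x ∈ U)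
    (hg : ∀ i, DifferentiableAt ℝ (g i) (p i x))
    (hG : ∀ i, ∀ x ∈ U, q i (G x) = g i (p i x)) :
    ∃ f' : X →L[ℝ] Y, ∀ i v, q i (f' v) = fderiv ℝ (g i) (p i x) (p i v) := by
  have key (v : X) : (fun i => fderiv ℝ (g i) (p i x) (p i v)) ∈
      range (fun (y : Y) i => q i y) := by
    -- The derivatives of the levels are the coordinatewise limit of difference quotients of `G`,
    -- which lie in the image of `Y`; closedness of the image keeps the limit there.
    refine hq.isClosed_range.mem_of_tendsto (b := 𝓝[≠] (0 : ℝ))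
      (f := fun t i => q i (t⁻¹ • (G (x + t • v) - G x))) ?_
      (Eventually.of_forall fun t => mem_range_self _)
    rw [tendsto_pi_nhds]
    intro i
    have h1 : HasDerivAt (fun t : ℝ => g i (p i x + t • p i v))
        (fderiv ℝ (g i) (p i x) (p i v)) 0 := by
      have h2 : HasDerivAt (fun t : ℝ => p i x + t • p i v) (p i v) 0 := by
        simpa using ((hasDerivAt_id (0 : ℝ)).smul_const (p i v)).const_add (p i x)
      refine HasFDerivAt.comp_hasDerivAt (f := fun t : ℝ => p i x + t • p i v) 0 ?_ h2
      simpa using (hg i).hasFDerivAt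
    refine (hasDerivAt_iff_tendsto_slope_zero.1 h1).congr' ?_
    have hmem : ∀ᶠ t : ℝ in 𝓝[≠] 0, x + t • v ∈ U :=
      (Continuous.tendsto' (by fun_prop) (0 : ℝ) x (by simp)).mono_left nhdsWithin_le_nhds
        |>.eventually (hU.mem_nhds hx)
    filter_upwards [hmem] with t ht
    simp [hG i _ ht, hG i _ hx]
  choose y hy using key
  have hy' (i v) : q i (y v) = fderiv ℝ (g i) (p i x) (p i v) := congrFun (hy v) i
  have hinj {a b : Y} (h : ∀ i, q i a = q i b) : a = b := hq.injective (funext h)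
  refine ⟨⟨⟨⟨y, fun a b => hinj fun i => ?_⟩, fun c a => hinj fun i => ?_⟩, ?_⟩, hy'⟩
  · simp [hy']
  · simp [hy']
  · refine hq.isInducing.continuous_iff.2 (continuous_pi fun i => ?_)
    have : Continuous fun v => fderiv ℝ (g i) (p i x) (p i v) := by fun_prop
    exact this.congr fun v => (hy' i v).symm

/-- The topology of `Y` is induced by the maps `q i`, and the i-th component of the remainder is the
remainder of `g i` composed with (t, v) ↦ (t, p i v). -/
theorem hasLeslieDerivAt_of_levels (hq : IsClosedEmbedding (fun (y : Y) i => q i y))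
    {X : Type*} [AddCommGroup X] [Module ℝ X] [TopologicalSpace X] [ContinuousAdd X]
    [ContinuousSMul ℝ X]
    {A : ι → Type*} [∀ i, NormedAddCommGroup (A i)] [∀ i, NormedSpace ℝ (A i)]
    {p : ∀ i, X →L[ℝ] A i} {G : X → Y} {U : Set X} (hU : IsOpen U)
    {g : ∀ i, A i → B i} {x : X} (hx : x ∈ U)
    (hg : ∀ i, DifferentiableAt ℝ (g i) (p i x))
    (hG : ∀ i, ∀ x ∈ U, q i (G x) = g i (p i x)) {f' : X →L[ℝ] Y}
    (hf' : ∀ i v, q i (f' v) = fderiv ℝ (g i) (p i x) (p i v)) : HasLeslieDerivAt G f' x := by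
  intro v
  refine hq.isInducing.continuousAt_iff.2 (continuousAt_pi.2 fun i => ?_)
  have h1 := hasLeslieDerivAt_of_hasFDerivAt (hg i).hasFDerivAt (p i v)
  have h2 : ContinuousAt (fun z : ℝ × X => (z.1, p i z.2)) (0, v) := by fun_prop
  have h3 := ContinuousAt.comp (f := fun z : ℝ × X => (z.1, p i z.2)) (x := ((0 : ℝ), v)) h1 h2
  refine h3.congr ?_
  have hmem : ∀ᶠ z : ℝ × X in 𝓝 (0, v), x + z.1 • z.2 ∈ U :=
    (Continuous.tendsto' (by fun_prop) ((0 : ℝ), v) x (by simp)).eventually (hU.mem_nhds hx)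
  filter_upwards [hmem] with z hz
  simp [hG i _ hz, hG i _ hx, hf']

/-- The class of levelwise maps is closed under (x, v) ↦ DG(x) v: this map is given on the levels A
i × A i by the smooth maps (a, b) ↦ D(g i)(a) b. The induction therefore runs over all domains at
once. -/
theorem leslieC_of_levels (hq : IsClosedEmbedding (fun (y : Y) i => q i y)) (n : ℕ) :
    ∀ {X : Type u₂} [AddCommGroup X] [Module ℝ X] [TopologicalSpace X] [ContinuousAdd X]
      [ContinuousSMul ℝ X]
      {A : ι → Type u₂} [∀ i, NormedAddCommGroup (A i)] [∀ i, NormedSpace ℝ (A i)]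
      {p : ∀ i, X →L[ℝ] A i} {G : X → Y} {U : Set X} (_ : IsOpen U)
      {V : ∀ i, Set (A i)} (_ : ∀ i, IsOpen (V i)) {g : ∀ i, A i → B i}
      (_ : ∀ i, ContDiffOn ℝ ∞ (g i) (V i)) (_ : ∀ i, ∀ x ∈ U, p i x ∈ V i)
      (_ : ∀ i, ∀ x ∈ U, q i (G x) = g i (p i x)), LeslieC n X G U := by
  have hcont {X : Type u₂} [AddCommGroup X] [Module ℝ X] [TopologicalSpace X]
      {A : ι → Type u₂} [∀ i, NormedAddCommGroup (A i)] [∀ i, NormedSpace ℝ (A i)]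
      {p : ∀ i, X →L[ℝ] A i} {G : X → Y} {U : Set X}
      {V : ∀ i, Set (A i)} {g : ∀ i, A i → B i}
      (hg : ∀ i, ContDiffOn ℝ ∞ (g i) (V i)) (hp : ∀ i, ∀ x ∈ U, p i x ∈ V i)
      (hG : ∀ i, ∀ x ∈ U, q i (G x) = g i (p i x)) : ContinuousOn G U := by
    refine hq.isInducing.continuousOn_iff.2 (continuousOn_pi.2 fun i => ?_)
    exact ((hg i).continuousOn.comp (p i).continuous.continuousOn (hp i)).congr (hG i)
  induction n with
  | zero => intro X _ _ _ _ _ A _ _ p G U hU V hV g hg hp hG; exact hcont hg hp hG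
  | succ n ih =>
    intro X _ _ _ _ _ A _ _ p G U hU V hV g hg hp hG
    refine ⟨hcont hg hp hG, ?_⟩
    have hd (x : X) (hx : x ∈ U) (i) : DifferentiableAt ℝ (g i) (p i x) :=
      ((hg i).contDiffAt ((hV i).mem_nhds (hp i x hx))).differentiableAt (by simp)
    -- The differential must be a function on all of `X`; off `U` it is set to 0.
    have hex (x : X) : ∃ f' : X →L[ℝ] Y, x ∈ U →
        ∀ i v, q i (f' v) = fderiv ℝ (g i) (p i x) (p i v) := by
      by_cases hx : x ∈ U
      · obtain ⟨f', h⟩ := exists_limit_fderiv hq hU hx (hd x hx) hG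
        exact ⟨f', fun _ => h⟩
      · exact ⟨0, fun h => absurd h hx⟩
    choose f' hf' using hex
    refine ⟨f', fun x hx => hasLeslieDerivAt_of_levels hq hU hx (hd x hx) hG (hf' x hx), ?_⟩
    refine ih (A := fun i => A i × A i) (p := fun i => (p i).prodMap (p i))
      (V := fun i => V i ×ˢ univ) (g := fun i z => fderiv ℝ (g i) z.1 z.2)
      (hU.prod isOpen_univ) (fun i => (hV i).prod isOpen_univ) (fun i => ?_)
      (fun i x hx => ⟨hp i _ hx.1, mem_univ _⟩) (fun i x hx => hf' x.1 hx.1 i x.2)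
    exact (((contDiffOn_infty_iff_fderiv_of_isOpen (hV i)).1 (hg i)).2.comp contDiffOn_fst
      (fun z hz => hz.1)).clm_apply contDiffOn_snd

theorem leslieSmoothOn_of_levels (hq : IsClosedEmbedding (fun (y : Y) i => q i y))
    {X : Type u₂} [AddCommGroup X] [Module ℝ X] [TopologicalSpace X] [ContinuousAdd X]
    [ContinuousSMul ℝ X]
    {A : ι → Type u₂} [∀ i, NormedAddCommGroup (A i)] [∀ i, NormedSpace ℝ (A i)]
    (p : ∀ i, X →L[ℝ] A i) {G : X → Y} {U : Set X} (hU : IsOpen U)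
    (V : ∀ i, Set (A i)) (hV : ∀ i, IsOpen (V i)) (g : ∀ i, A i → B i)
    (hg : ∀ i, ContDiffOn ℝ ∞ (g i) (V i)) (hp : ∀ i, ∀ x ∈ U, p i x ∈ V i)
    (hG : ∀ i, ∀ x ∈ U, q i (G x) = g i (p i x)) : LeslieSmoothOn G U :=
  fun n => leslieC_of_levels hq n hU hV hg hp hG

/-- Twice differentiable curves in topological vector spaces. -/
theorem exists_slopes_of_leslieC_two {F : Type*} [AddCommGroup F] [Module ℝ F]
    [TopologicalSpace F] [ContinuousAdd F] {f : ℝ → F} {U : Set ℝ} (h : LeslieC 2 ℝ f U) :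
    ∃ d : ℝ → F,
      (∀ t ∈ U, Tendsto (fun h : ℝ => h⁻¹ • (f (t + h) - f t)) (𝓝[≠] 0) (𝓝 (d t))) ∧
      ∀ t ∈ U, ∃ a, Tendsto (fun h : ℝ => h⁻¹ • (d (t + h) - d t)) (𝓝[≠] 0) (𝓝 a) := by
  obtain ⟨-, f', hf', -, f'', hf'', -⟩ := h
  -- The velocity is the differential applied to 1; varying t with the vector 1 fixed is the
  -- direction (1, 0) for the second differential.
  refine ⟨fun t => f' t 1, fun t ht => ?_, fun t ht => ⟨f'' (t, 1) (1, 0), ?_⟩⟩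
  · simpa using tendsto_slope_of_hasLeslieDerivAt (hf' t ht) 1
  · simpa using tendsto_slope_of_hasLeslieDerivAt (hf'' (t, 1) ⟨ht, mem_univ _⟩) (1, 0)

theorem curveDeriv_eq_of_tendsto {F : Type*} [AddCommGroup F] [Module ℝ F]
    [TopologicalSpace F] [T2Space F] {f : ℝ → F} {t : ℝ} {d : F}
    (h : Tendsto (fun h : ℝ => h⁻¹ • (f (t + h) - f t)) (𝓝[≠] 0) (𝓝 d)) :
    curveDeriv f t = d := by
  have : Nonempty F := ⟨d⟩
  exact h.limUnder_eq

end LeslieCalculus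

/-- The chain rule on both sides of g ∘ f = L ∘ h. It serves for a connecting map that is linear in
charts, and again for its tangent map. -/
theorem mfderiv_apply_of_eventuallyEq
    {E : Type*} [NormedAddCommGroup E] [NormedSpace ℝ E] {H : Type*} [TopologicalSpace H]
    {I : ModelWithCorners ℝ E H} {N : Type*} [TopologicalSpace N] [ChartedSpace H N]
    {E' : Type*} [NormedAddCommGroup E'] [NormedSpace ℝ E'] {H' : Type*} [TopologicalSpace H']
    {I' : ModelWithCorners ℝ E' H'} {N' : Type*} [TopologicalSpace N'] [ChartedSpace H' N']
    {F : Type*} [NormedAddCommGroup F] [NormedSpace ℝ F]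
    {F' : Type*} [NormedAddCommGroup F'] [NormedSpace ℝ F']
    {f : N → N'} {g : N' → F'} {h : N → F} (L : F →L[ℝ] F') {x : N}
    (hg : MDifferentiableAt I' 𝓘(ℝ, F') g (f x)) (hf : MDifferentiableAt I I' f x)
    (hh : MDifferentiableAt I 𝓘(ℝ, F) h x) (heq : g ∘ f =ᶠ[𝓝 x] L ∘ h) (a : TangentSpace I x) :
    (mfderiv I' 𝓘(ℝ, F') g (f x) (mfderiv I I' f x a) : F') = L (mfderiv I 𝓘(ℝ, F) h x a) := by
  have h1 := mfderiv_comp_apply (I' := I') x hg hf a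
  have h2 := mfderiv_comp_apply (I' := 𝓘(ℝ, F)) (g := L) x
    L.differentiableAt.mdifferentiableAt hh a
  rw [mfderiv_eq_fderiv, L.fderiv] at h2
  exact h1.symm.trans ((congrArg (fun T : E →L[ℝ] F' => T a) heq.mfderiv_eq).trans h2)

/-! ### Coordinates on TN and T(TN), and Christoffel symbols -/

section ChristoffelSymbols

variable {E : Type*} [NormedAddCommGroup E] [NormedSpace ℝ E]
  {N : Type*} [TopologicalSpace N] [ChartedSpace E N]
  {e e' : OpenPartialHomeomorph N E}

theorem mdifferentiableAt_of_mem_maximalAtlas (he : e ∈ IsManifold.maximalAtlas 𝓘(ℝ, E) ∞ N)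
    {x : N} (hx : x ∈ e.source) : MDifferentiableAt 𝓘(ℝ, E) 𝓘(ℝ, E) e x :=
  ((contMDiffOn_of_mem_maximalAtlas he).contMDiffAt (e.open_source.mem_nhds hx)).mdifferentiableAt
    (by simp)

theorem mdifferentiableAt_symm_of_mem_maximalAtlas
    (he : e ∈ IsManifold.maximalAtlas 𝓘(ℝ, E) ∞ N)
    {y : E} (hy : y ∈ e.target) : MDifferentiableAt 𝓘(ℝ, E) 𝓘(ℝ, E) e.symm y :=
  ((contMDiffOn_symm_of_mem_maximalAtlas he).contMDiffAt
    (e.open_target.mem_nhds hy)).mdifferentiableAt (by simp)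

theorem contDiffOn_chart_change (he : e ∈ IsManifold.maximalAtlas 𝓘(ℝ, E) ∞ N)
    (he' : e' ∈ IsManifold.maximalAtlas 𝓘(ℝ, E) ∞ N) :
    ContDiffOn ℝ ∞ (e' ∘ e.symm) (e.symm.trans e').source := by
  rw [← contMDiffOn_iff_contDiffOn]
  refine (contMDiffOn_of_mem_maximalAtlas he').comp
    ((contMDiffOn_symm_of_mem_maximalAtlas he).mono ?_) ?_
  · intro y hy; exact hy.1
  · intro y hy; exact hy.2

/-- The inverse of the local coordinates `tangentCoord e` on the tangent bundle. -/
def tangentCoordSymm (e : OpenPartialHomeomorph N E) (z : E × E) : TangentBundle 𝓘(ℝ, E) N :=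
  ⟨e.symm z.1, mfderiv 𝓘(ℝ, E) 𝓘(ℝ, E) e.symm z.1 z.2⟩

theorem tangentCoord_tangentCoordSymm (he : e ∈ IsManifold.maximalAtlas 𝓘(ℝ, E) ∞ N)
    (he' : e' ∈ IsManifold.maximalAtlas 𝓘(ℝ, E) ∞ N) {z : E × E}
    (hz : z.1 ∈ (e.symm.trans e').source) :
    tangentCoord e' (tangentCoordSymm e z)
      = ((e' ∘ e.symm) z.1, fderiv ℝ (e' ∘ e.symm) z.1 z.2) := by
  refine Prod.ext rfl ?_
  rw [← mfderiv_eq_fderiv]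
  exact (mfderiv_comp_apply (I' := 𝓘(ℝ, E)) z.1
    (mdifferentiableAt_of_mem_maximalAtlas he' hz.2)
    (mdifferentiableAt_symm_of_mem_maximalAtlas he hz.1) z.2).symm

theorem tangentCoordSymm_tangentCoord (he : e ∈ IsManifold.maximalAtlas 𝓘(ℝ, E) ∞ N)
    {p : TangentBundle 𝓘(ℝ, E) N} (hp : p.proj ∈ e.source) :
    tangentCoordSymm e (tangentCoord e p) = p := by
  obtain ⟨x, a⟩ := p
  have hx : x ∈ e.source := hp
  have h1 : e.symm ∘ e =ᶠ[𝓝 x] id := by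
    filter_upwards [e.open_source.mem_nhds hx] with z hz using e.left_inv hz
  have h2 := mfderiv_comp_apply (I' := 𝓘(ℝ, E)) x
    (mdifferentiableAt_symm_of_mem_maximalAtlas he (e.map_source hx))
    (mdifferentiableAt_of_mem_maximalAtlas he hx) a
  rw [h1.mfderiv_eq, mfderiv_id] at h2
  have h3 : e.symm (e x) = x := e.left_inv hx
  refine Bundle.TotalSpace.ext h3 (heq_of_eq ?_)
  exact h2.symm

variable [IsManifold 𝓘(ℝ, E) ∞ N]

theorem contMDiffOn_tangentMap {E' : Type*} [NormedAddCommGroup E'] [NormedSpace ℝ E']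
    {N' : Type*} [TopologicalSpace N'] [ChartedSpace E' N'] [IsManifold 𝓘(ℝ, E') ∞ N']
    {f : N → N'} {s : Set N} (hs : IsOpen s) (hf : ContMDiffOn 𝓘(ℝ, E) 𝓘(ℝ, E') ∞ f s) :
    ContMDiffOn 𝓘(ℝ, E).tangent 𝓘(ℝ, E').tangent ∞ (tangentMap 𝓘(ℝ, E) 𝓘(ℝ, E') f)
      (Bundle.TotalSpace.proj ⁻¹' s) := by
  have : IsManifold 𝓘(ℝ, E) 1 N := IsManifold.of_le (n := ∞) (by simp)
  have : IsManifold 𝓘(ℝ, E') 1 N' := IsManifold.of_le (n := ∞) (by simp)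
  refine (hf.contMDiffOn_tangentMapWithin (m := ∞) (by simp) hs.uniqueMDiffOn).congr ?_
  intro p hp
  simp only [tangentMapWithin, tangentMap]
  rw [mfderivWithin_of_isOpen hs hp]

/-- These coordinates are the tangent map of `e` followed by the identification of the tangent
bundle of E with E × E. -/
theorem mdifferentiableAt_tangentCoord (he : e ∈ IsManifold.maximalAtlas 𝓘(ℝ, E) ∞ N)
    {p : TangentBundle 𝓘(ℝ, E) N} (hp : p.proj ∈ e.source) :
    MDifferentiableAt 𝓘(ℝ, E).tangent 𝓘(ℝ, E × E) (tangentCoord e) p := by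
  have h1 := contMDiffOn_tangentMap e.open_source (contMDiffOn_of_mem_maximalAtlas he)
  have h2 := (contMDiff_tangentBundleModelSpaceHomeomorph (n := ∞) (I := 𝓘(ℝ, E))).comp_contMDiffOn
    h1
  have hopen : IsOpen (Bundle.TotalSpace.proj ⁻¹' e.source : Set (TangentBundle 𝓘(ℝ, E) N)) :=
    e.open_source.preimage (FiberBundle.continuous_proj E (TangentSpace 𝓘(ℝ, E)))
  have h3 := (h2.contMDiffAt (hopen.mem_nhds hp)).mdifferentiableAt (by simp)
  rw [modelWithCornersSelf_prod]
  exact h3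

theorem mdifferentiableAt_tangentCoordSymm (he : e ∈ IsManifold.maximalAtlas 𝓘(ℝ, E) ∞ N)
    {z : E × E} (hz : z.1 ∈ e.target) :
    MDifferentiableAt 𝓘(ℝ, E × E) 𝓘(ℝ, E).tangent (tangentCoordSymm e) z := by
  have h1 := contMDiffOn_tangentMap e.open_target (contMDiffOn_symm_of_mem_maximalAtlas he)
  have h2 : ContMDiff 𝓘(ℝ, E × E) 𝓘(ℝ, E).tangent ∞
      (fun z : E × E => (tangentBundleModelSpaceHomeomorph 𝓘(ℝ, E)).symm z) := by
    rw [modelWithCornersSelf_prod]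
    exact contMDiff_tangentBundleModelSpaceHomeomorph_symm
  have h3 := h1.comp h2.contMDiffOn (s := (Prod.fst ⁻¹' e.target : Set (E × E))) fun z hz => hz
  have hopen : IsOpen (Prod.fst ⁻¹' e.target : Set (E × E)) :=
    e.open_target.preimage continuous_fst
  exact (h3.contMDiffAt (hopen.mem_nhds hz)).mdifferentiableAt (by simp)

/-- A vector of `T(TN)` with prescribed coordinates in the chart `e`. -/
def tangentTwoCoordSymm (e : OpenPartialHomeomorph N E) (z ζ : E × E) :
    TangentBundle 𝓘(ℝ, E).tangent (TangentBundle 𝓘(ℝ, E) N) :=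
  ⟨tangentCoordSymm e z, mfderiv 𝓘(ℝ, E × E) 𝓘(ℝ, E).tangent (tangentCoordSymm e) z ζ⟩

/-- The product rule for (y, u) ↦ (τ y, Dτ(y) u), τ = e' ∘ e⁻¹, in the direction (v, w). The
second-order term is the source of the inhomogeneous term in the law for Christoffel symbols. -/
theorem tangentTwoCoord_tangentTwoCoordSymm
    (he : e ∈ IsManifold.maximalAtlas 𝓘(ℝ, E) ∞ N)
    (he' : e' ∈ IsManifold.maximalAtlas 𝓘(ℝ, E) ∞ N) {y : E}
    (hy : y ∈ (e.symm.trans e').source) (u v w : E) :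
    tangentTwoCoord e' (tangentTwoCoordSymm e (y, u) (v, w))
      = (((e' ∘ e.symm) y, fderiv ℝ (e' ∘ e.symm) y u),
        (fderiv ℝ (e' ∘ e.symm) y v,
          fderiv ℝ (fderiv ℝ (e' ∘ e.symm)) y v u + fderiv ℝ (e' ∘ e.symm) y w)) := by
  have hO : IsOpen (e.symm.trans e').source := (e.symm.trans e').open_source
  have hcd := contDiffOn_chart_change he he'
  have hd : DifferentiableAt ℝ (e' ∘ e.symm) y :=
    (hcd.contDiffAt (hO.mem_nhds hy)).differentiableAt (by simp)
  have hdd : DifferentiableAt ℝ (fderiv ℝ (e' ∘ e.symm)) y :=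
    (((contDiffOn_infty_iff_fderiv_of_isOpen hO).1 hcd).2.contDiffAt
      (hO.mem_nhds hy)).differentiableAt (by simp)
  refine Prod.ext (tangentCoord_tangentCoordSymm he he' (z := (y, u)) hy) ?_
  have h1 := mfderiv_comp_apply (I' := 𝓘(ℝ, E).tangent) (y, u)
    (mdifferentiableAt_tangentCoord he' (p := tangentCoordSymm e (y, u)) hy.2)
    (mdifferentiableAt_tangentCoordSymm he (z := (y, u)) hy.1) (v, w)
  refine h1.symm.trans ?_
  rw [mfderiv_eq_fderiv]
  have h2 : tangentCoord e' ∘ tangentCoordSymm e =ᶠ[𝓝 (y, u)]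
      fun z => ((e' ∘ e.symm) z.1, fderiv ℝ (e' ∘ e.symm) z.1 z.2) := by
    filter_upwards [(hO.preimage continuous_fst).mem_nhds (x := (y, u)) hy] with z hz
    exact tangentCoord_tangentCoordSymm he he' hz
  rw [h2.fderiv_eq]
  have h3 : HasFDerivAt (fun z : E × E => (e' ∘ e.symm) z.1)
      ((fderiv ℝ (e' ∘ e.symm) y).comp (ContinuousLinearMap.fst ℝ E E)) (y, u) :=
    HasFDerivAt.comp (y, u) (g := e' ∘ e.symm) hd.hasFDerivAt hasFDerivAt_fst
  have h4 : HasFDerivAt (fun z : E × E => fderiv ℝ (e' ∘ e.symm) z.1)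
      ((fderiv ℝ (fderiv ℝ (e' ∘ e.symm)) y).comp (ContinuousLinearMap.fst ℝ E E)) (y, u) :=
    HasFDerivAt.comp (y, u) (g := fderiv ℝ (e' ∘ e.symm)) hdd.hasFDerivAt hasFDerivAt_fst
  have h5 := h3.prodMk (h4.clm_apply hasFDerivAt_snd)
  rw [h5.fderiv]
  exact Prod.ext rfl (add_comm _ _)

theorem tangentTwoCoord_tangentTwoCoordSymm_self
    (he : e ∈ IsManifold.maximalAtlas 𝓘(ℝ, E) ∞ N) {y : E} (hy : y ∈ e.target) (u v w : E) :
    tangentTwoCoord e (tangentTwoCoordSymm e (y, u) (v, w)) = ((y, u), (v, w)) := by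
  have h0 : e ∘ e.symm =ᶠ[𝓝 y] id := by
    filter_upwards [e.open_target.mem_nhds hy] with z hz
    exact e.right_inv hz
  rw [tangentTwoCoord_tangentTwoCoordSymm he he ⟨hy, e.map_target hy⟩]
  have h1 : fderiv ℝ (e ∘ e.symm) =ᶠ[𝓝 y] fun _ => ContinuousLinearMap.id ℝ E :=
    h0.fderiv.trans (Eventually.of_forall fun z => fderiv_id)
  rw [h1.fderiv_eq, h1.eq_of_nhds, h0.eq_of_nhds]
  simp

/-- The transformation law of the Christoffel symbols. -/
theorem LinearConnection.christoffel_chart_change (D : LinearConnection E N)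
    (he : e ∈ IsManifold.maximalAtlas 𝓘(ℝ, E) ∞ N)
    (he' : e' ∈ IsManifold.maximalAtlas 𝓘(ℝ, E) ∞ N) {y : E}
    (hy : y ∈ (e.symm.trans e').source) (u v : E) :
    fderiv ℝ (fderiv ℝ (e' ∘ e.symm)) y v u
        + D.christoffel e' (e' (e.symm y)) (fderiv ℝ (e' ∘ e.symm) y u)
          (fderiv ℝ (e' ∘ e.symm) y v)
      = fderiv ℝ (e' ∘ e.symm) y (D.christoffel e y u v) := by
  -- The connection is tested on a vector with w = 0, where it returns only the Christoffel term in
  -- `e`. Its value is a tangent vector, so its coordinates in `e'` arise by Dτ; comparison with the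
  -- local form in `e'` gives the law.
  set ξ := tangentTwoCoordSymm e (y, u) (v, 0) with hξ
  have hys : e.symm y ∈ e.source := e.map_target hy.1
  have h1 := D.local_form e he ξ hys y u v 0
    (tangentTwoCoord_tangentTwoCoordSymm_self he hy.1 u v 0)
  have h2 := D.local_form e' he' ξ hy.2 _ _ _ _
    (tangentTwoCoord_tangentTwoCoordSymm he he' hy u v 0)
  have hproj : (D.D ξ).proj = e.symm y := D.proj_D ξ
  have h3 : tangentCoord e' (D.D ξ) = (e' (e.symm y), fderiv ℝ (e' ∘ e.symm) y
      (D.christoffel e y u v)) := by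
    rw [← tangentCoordSymm_tangentCoord he (p := D.D ξ) (by rwa [hproj]), h1,
      tangentCoord_tangentCoordSymm he he' hy]
    simp
  rw [h3] at h2
  simpa using (congrArg Prod.snd h2).symm

/-- Connections that are related by a smooth map have related Christoffel symbols. -/
theorem LinearConnection.christoffel_related
    {E' : Type*} [NormedAddCommGroup E'] [NormedSpace ℝ E']
    {N' : Type*} [TopologicalSpace N'] [ChartedSpace E' N'] [IsManifold 𝓘(ℝ, E') ∞ N']
    {φ : N → N'} (hφ : ContMDiff 𝓘(ℝ, E) 𝓘(ℝ, E') ∞ φ) {r : E →L[ℝ] E'}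
    {k : OpenPartialHomeomorph N' E'}
    (he : e ∈ IsManifold.maximalAtlas 𝓘(ℝ, E) ∞ N)
    (hk : k ∈ IsManifold.maximalAtlas 𝓘(ℝ, E') ∞ N')
    (hmap : ∀ x ∈ e.source, φ x ∈ k.source) (hcomm : ∀ x ∈ e.source, k (φ x) = r (e x))
    (D : LinearConnection E N) (D' : LinearConnection E' N')
    (hD : ∀ ξ, tangentMap 𝓘(ℝ, E) 𝓘(ℝ, E') φ (D.D ξ)
      = D'.D (tangentMap 𝓘(ℝ, E).tangent 𝓘(ℝ, E').tangent (tangentMap 𝓘(ℝ, E) 𝓘(ℝ, E') φ) ξ))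
    {y : E} (hy : y ∈ e.target) (u v : E) :
    r (D.christoffel e y u v) = D'.christoffel k (r y) (r u) (r v) := by
  have hφd (x : N) : MDifferentiableAt 𝓘(ℝ, E) 𝓘(ℝ, E') φ x := (hφ x).mdifferentiableAt (by simp)
  -- In the charts φ is the linear map r, hence Tφ is r × r.
  have hT (p : TangentBundle 𝓘(ℝ, E) N) (hp : p.proj ∈ e.source) :
      tangentCoord k (tangentMap 𝓘(ℝ, E) 𝓘(ℝ, E') φ p) = (r.prodMap r) (tangentCoord e p) := by
    refine Prod.ext (hcomm _ hp) ?_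
    refine mfderiv_apply_of_eventuallyEq r
      (mdifferentiableAt_of_mem_maximalAtlas hk (hmap _ hp)) (hφd p.proj)
      (mdifferentiableAt_of_mem_maximalAtlas he hp) ?_ p.2
    filter_upwards [e.open_source.mem_nhds hp] with x hx using hcomm x hx
  set ξ := tangentTwoCoordSymm e (y, u) (v, 0) with hξ
  have hys : e.symm y ∈ e.source := e.map_target hy
  have hξc := tangentTwoCoord_tangentTwoCoordSymm_self he hy u v 0
  have h1 := D.local_form e he ξ hys y u v 0 hξc
  have hproj : (D.D ξ).proj ∈ e.source := by rw [D.proj_D ξ]; exact hys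
  -- As Tφ is linear in coordinates, T(Tφ) adds no second-order term and w = 0 is preserved.
  have hTT : tangentTwoCoord k (tangentMap 𝓘(ℝ, E).tangent 𝓘(ℝ, E').tangent
      (tangentMap 𝓘(ℝ, E) 𝓘(ℝ, E') φ) ξ) = ((r y, r u), (r v, 0)) := by
    have hp : ξ.proj.proj ∈ e.source := hys
    have hTφ : MDifferentiableAt 𝓘(ℝ, E).tangent 𝓘(ℝ, E').tangent
        (tangentMap 𝓘(ℝ, E) 𝓘(ℝ, E') φ) ξ.proj :=
      ((contMDiffOn_tangentMap isOpen_univ hφ.contMDiffOn).contMDiffAt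
        (by simp)).mdifferentiableAt (by simp)
    have hopen : IsOpen (Bundle.TotalSpace.proj ⁻¹' e.source : Set (TangentBundle 𝓘(ℝ, E) N)) :=
      e.open_source.preimage (FiberBundle.continuous_proj E (TangentSpace 𝓘(ℝ, E)))
    have h6 : tangentCoord k ∘ tangentMap 𝓘(ℝ, E) 𝓘(ℝ, E') φ =ᶠ[𝓝 ξ.proj]
        (r.prodMap r) ∘ tangentCoord e := by
      filter_upwards [hopen.mem_nhds hp] with p hp using hT p hp
    have h4 := mfderiv_apply_of_eventuallyEq (r.prodMap r)
      (mdifferentiableAt_tangentCoord hk (p := tangentMap 𝓘(ℝ, E) 𝓘(ℝ, E') φ ξ.proj)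
        (hmap _ hp)) hTφ (mdifferentiableAt_tangentCoord he hp) h6 ξ.2
    have h7 : (tangentTwoCoord e ξ).1 = (y, u) := congrArg Prod.fst hξc
    have h8 : (tangentTwoCoord e ξ).2 = (v, 0) := congrArg Prod.snd hξc
    refine Prod.ext ((hT _ hp).trans ?_) (h4.trans ?_)
    · exact (congrArg (r.prodMap r) h7).trans rfl
    · exact (congrArg (r.prodMap r) h8).trans (by simp)
  have h2 := D'.local_form k hk _ (hmap _ hys) _ _ _ _ hTT
  rw [← hD, hT _ hproj, h1] at h2
  simpa using congrArg Prod.snd h2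

end ChristoffelSymbols

/-! ### Closed embeddings in products -/

section ClosedEmbeddings

/-- Taking products levelwise preserves closed embeddings in products. -/
theorem isClosedEmbedding_pi_prodMk {ι : Type*} {X Y : Type*} [TopologicalSpace X]
    [TopologicalSpace Y] {A B : ι → Type*} [∀ i, TopologicalSpace (A i)]
    [∀ i, TopologicalSpace (B i)] {q : ∀ i, X → A i} {r : ∀ i, Y → B i}
    (hq : IsClosedEmbedding fun x i => q i x) (hr : IsClosedEmbedding fun y i => r i y) :
    IsClosedEmbedding fun (z : X × Y) i => (q i z.1, r i z.2) := by
  let h : ((∀ i, A i) × (∀ i, B i)) ≃ₜ (∀ i, A i × B i) :=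
    { toFun := fun f i => (f.1 i, f.2 i)
      invFun := fun f => (fun i => (f i).1, fun i => (f i).2)
      left_inv := fun _ => rfl
      right_inv := fun _ => rfl
      continuous_toFun := by fun_prop
      continuous_invFun := by fun_prop }
  have hm : IsClosedEmbedding fun z : X × Y => ((fun i => q i z.1, fun i => r i z.2) :
      (∀ i, A i) × (∀ i, B i)) := by
    refine ⟨hq.isEmbedding.prodMap hr.isEmbedding, ?_⟩
    have := hq.isClosed_range.prod hr.isClosed_range
    rwa [← range_prodMap] at this
  exact h.isClosedEmbedding.comp hm

end ClosedEmbeddings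

/-! ### Differentials of chart changes at a point -/

section ChartChange

theorem chart_mem_trans_source {E N : Type*} [TopologicalSpace E] [TopologicalSpace N]
    {e e' : OpenPartialHomeomorph N E} {x : N} (hx : x ∈ e.source) (hx' : x ∈ e'.source) :
    e x ∈ (e.symm.trans e').source :=
  ⟨e.map_source hx, by
    change e.symm (e x) ∈ e'.source
    rwa [e.left_inv hx]⟩

variable {E : Type*} [NormedAddCommGroup E] [NormedSpace ℝ E]
  {N : Type*} [TopologicalSpace N]
  {e e' e'' : OpenPartialHomeomorph N E}

/-- The differential of the change of charts from `e` to `e'` at the point `x`. -/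
def chartChangeDeriv (e e' : OpenPartialHomeomorph N E) (x : N) : E →L[ℝ] E :=
  fderiv ℝ (e' ∘ e.symm) (e x)

theorem chartChangeDeriv_self {x : N} (hx : x ∈ e.source) :
    chartChangeDeriv e e x = ContinuousLinearMap.id ℝ E := by
  have h : e ∘ e.symm =ᶠ[𝓝 (e x)] id := by
    filter_upwards [e.open_target.mem_nhds (e.map_source hx)] with z hz using e.right_inv hz
  rw [chartChangeDeriv, h.fderiv_eq, fderiv_id]

variable [ChartedSpace E N]

theorem differentiableAt_chart_change (he : e ∈ IsManifold.maximalAtlas 𝓘(ℝ, E) ∞ N)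
    (he' : e' ∈ IsManifold.maximalAtlas 𝓘(ℝ, E) ∞ N) {x : N} (hx : x ∈ e.source)
    (hx' : x ∈ e'.source) : DifferentiableAt ℝ (e' ∘ e.symm) (e x) :=
  ((contDiffOn_chart_change he he').contDiffAt ((e.symm.trans e').open_source.mem_nhds
    (chart_mem_trans_source hx hx'))).differentiableAt (by simp)

/-- The chain rule; this is the cocycle identity on each level, and with e'' = e it yields
invertibility. -/
theorem chartChangeDeriv_comp (he : e ∈ IsManifold.maximalAtlas 𝓘(ℝ, E) ∞ N)
    (he' : e' ∈ IsManifold.maximalAtlas 𝓘(ℝ, E) ∞ N)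
    (he'' : e'' ∈ IsManifold.maximalAtlas 𝓘(ℝ, E) ∞ N) {x : N} (hx : x ∈ e.source)
    (hx' : x ∈ e'.source) (hx'' : x ∈ e''.source) :
    (chartChangeDeriv e' e'' x).comp (chartChangeDeriv e e' x) = chartChangeDeriv e e'' x := by
  have h1 : (e' ∘ e.symm) (e x) = e' x := congrArg e' (e.left_inv hx)
  have h : e'' ∘ e.symm =ᶠ[𝓝 (e x)] (e'' ∘ e'.symm) ∘ (e' ∘ e.symm) := by
    filter_upwards [(e.symm.trans e').open_source.mem_nhds (chart_mem_trans_source hx hx')]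
      with z hz
    exact congrArg e'' (e'.left_inv hz.2).symm
  have h2 := differentiableAt_chart_change he' he'' hx' hx''
  rw [← h1] at h2
  rw [chartChangeDeriv, chartChangeDeriv, chartChangeDeriv, h.fderiv_eq,
    fderiv_comp _ h2 (differentiableAt_chart_change he he' hx hx'), h1]

/-- The differential of the change of charts, acting diagonally on `E × E`. -/
def chartChangeUnit (he : e ∈ IsManifold.maximalAtlas 𝓘(ℝ, E) ∞ N)
    (he' : e' ∈ IsManifold.maximalAtlas 𝓘(ℝ, E) ∞ N) {x : N} (hx : x ∈ e.source)
    (hx' : x ∈ e'.source) : ((E × E) →L[ℝ] (E × E))ˣ where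
  val := (chartChangeDeriv e e' x).prodMap (chartChangeDeriv e e' x)
  inv := (chartChangeDeriv e' e x).prodMap (chartChangeDeriv e' e x)
  val_inv := by
    have h := chartChangeDeriv_comp he' he he' hx' hx hx'
    rw [chartChangeDeriv_self hx'] at h
    ext z
    · simpa using DFunLike.congr_fun h z
    · simp
    · simp
    · simpa using DFunLike.congr_fun h z
  inv_val := by
    have h := chartChangeDeriv_comp he he' he hx hx' hx
    rw [chartChangeDeriv_self hx] at h
    ext z
    · simpa using DFunLike.congr_fun h z
    · simp
    · simp
    · simpa using DFunLike.congr_fun h z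

theorem contDiffOn_fderiv_chart_change (he : e ∈ IsManifold.maximalAtlas 𝓘(ℝ, E) ∞ N)
    (he' : e' ∈ IsManifold.maximalAtlas 𝓘(ℝ, E) ∞ N) :
    ContDiffOn ℝ ∞ (fderiv ℝ (e' ∘ e.symm)) (e.symm.trans e').source :=
  ((contDiffOn_infty_iff_fderiv_of_isOpen (e.symm.trans e').open_source).1
    (contDiffOn_chart_change he he')).2

theorem continuousOn_chartChangeDeriv (he : e ∈ IsManifold.maximalAtlas 𝓘(ℝ, E) ∞ N)
    (he' : e' ∈ IsManifold.maximalAtlas 𝓘(ℝ, E) ∞ N) :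
    ContinuousOn (chartChangeDeriv e e') (e.source ∩ e'.source) :=
  (contDiffOn_fderiv_chart_change he he').continuousOn.comp
    (e.continuousOn.mono inter_subset_left) fun _ hx => chart_mem_trans_source hx.1 hx.2

/-- A third chart `b` is needed because smoothness on M is tested in every limit chart. Read in `b`,
the differential is D(e' ∘ e⁻¹) composed with the chart change e ∘ b⁻¹. -/
theorem contDiffOn_chartChangeDeriv {b : OpenPartialHomeomorph N E}
    (hb : b ∈ IsManifold.maximalAtlas 𝓘(ℝ, E) ∞ N)
    (he : e ∈ IsManifold.maximalAtlas 𝓘(ℝ, E) ∞ N)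
    (he' : e' ∈ IsManifold.maximalAtlas 𝓘(ℝ, E) ∞ N) :
    ContDiffOn ℝ ∞ (fun y => chartChangeDeriv e e' (b.symm y))
      (b.target ∩ b.symm ⁻¹' (e.source ∩ e'.source)) :=
  (contDiffOn_fderiv_chart_change he he').comp
    ((contDiffOn_chart_change hb he).mono fun _ hy => ⟨hy.1, hy.2.1⟩)
    fun _ hy => chart_mem_trans_source hy.2.1 hy.2.2

end ChartChange

namespace ProjSystem

variable {E : ℕ → Type u} [∀ i, NormedAddCommGroup (E i)] [∀ i, NormedSpace ℝ (E i)]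
variable {M : ℕ → Type v} [∀ i, TopologicalSpace (M i)] [∀ i, ChartedSpace (E i) (M i)]
variable (S : ProjSystem E M)

/-! ### The Fréchet spaces `𝔽` and `H(𝔽 × 𝔽)` as closed subspaces of products -/

/-- The projection `𝔽 → E i`. -/
def modelProj (i : ℕ) : S.Model →L[ℝ] E i :=
  (ContinuousLinearMap.proj i).comp S.Model.subtypeL

/-- The projection `H(𝔽 × 𝔽) → L(E i × E i)`. -/
def hProj (i : ℕ) : S.H →L[ℝ] ((E i × E i) →L[ℝ] (E i × E i)) :=
  (ContinuousLinearMap.proj i).comp S.H.subtypeL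

/-- The projection `𝔽 × (𝔽 × 𝔽) → E i × (E i × E i)`. -/
def totalProj (i : ℕ) : (S.Model × (S.Model × S.Model)) →L[ℝ] (E i × (E i × E i)) :=
  (S.modelProj i).prodMap ((S.modelProj i).prodMap (S.modelProj i))

/-- The compatibility conditions are equations between continuous maps into Hausdorff spaces, hence
closed. -/
theorem isClosedEmbedding_modelProj :
    IsClosedEmbedding fun (y : S.Model) i => S.modelProj i y := by
  have h : IsClosed (S.Model : Set (∀ i, E i)) := by
    have : (S.Model : Set (∀ i, E i)) = ⋂ (i) (j) (h : i ≤ j), {x | S.ρ h (x j) = x i} := by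
      ext x; simp [Model]
    rw [this]
    exact isClosed_iInter fun i => isClosed_iInter fun j => isClosed_iInter fun h =>
      isClosed_eq (by fun_prop) (by fun_prop)
  exact h.isClosedEmbedding_subtypeVal

theorem isClosedEmbedding_hProj : IsClosedEmbedding fun (l : S.H) i => S.hProj i l := by
  have h : IsClosed (S.H : Set (∀ i, (E i × E i) →L[ℝ] (E i × E i))) := by
    have : (S.H : Set (∀ i, (E i × E i) →L[ℝ] (E i × E i))) = ⋂ (i) (j) (h : i ≤ j),
        {l | ((S.ρ h).prodMap (S.ρ h)).comp (l j)
          = (l i).comp ((S.ρ h).prodMap (S.ρ h))} := by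
      ext x; simp only [mem_iInter]; rfl
    rw [this]
    exact isClosed_iInter fun i => isClosed_iInter fun j => isClosed_iInter fun h =>
      isClosed_eq (by fun_prop) (by fun_prop)
  exact h.isClosedEmbedding_subtypeVal

theorem isClosedEmbedding_totalProj :
    IsClosedEmbedding fun (y : S.Model × (S.Model × S.Model)) i => S.totalProj i y :=
  isClosedEmbedding_pi_prodMk S.isClosedEmbedding_modelProj
    (isClosedEmbedding_pi_prodMk S.isClosedEmbedding_modelProj S.isClosedEmbedding_modelProj)

variable {S}

theorem model_ext {a b : S.Model} (h : ∀ i, a.1 i = b.1 i) : a = b := Subtype.ext (funext h)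

theorem LimitChart.toChart_apply (c : S.LimitChart) {x : S.Lim} (hx : x ∈ c.toChart.source)
    (i : ℕ) : (c.toChart x).1 i = c.chart i (x.1 i) := by
  have h : ∀ i, x.1 i ∈ (c.chart i).source := hx
  have : c.toChart x = ⟨_, c.map_mem h⟩ := dif_pos h
  rw [this]

theorem LimitChart.toChart_symm_apply (c : S.LimitChart) {y : S.Model}
    (hy : y ∈ c.toChart.target) (i : ℕ) :
    (c.toChart.symm y).1 i = (c.chart i).symm (y.1 i) := by
  have h : ∀ i, y.1 i ∈ (c.chart i).target := hy
  have : c.toChart.symm y = ⟨_, c.symm_compat h⟩ := dif_pos h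
  rw [this]

theorem continuous_lim_apply (i : ℕ) : Continuous fun x : S.Lim => x.1 i :=
  (continuous_apply i).comp continuous_subtype_val

/-! ### The cocycle of the tangent bundle -/

/-- The relation ρ ∘ τʲ = τⁱ ∘ ρ holds on an open subset of E j, since the charts of a single level
have open domains; differentiating it gives the claim. -/
theorem chartChangeDeriv_compat (c c' : S.LimitChart) {i j : ℕ} (h : i ≤ j) {x : M j}
    (hx : x ∈ (c.chart j).source) (hx' : x ∈ (c'.chart j).source) :
    (S.ρ h).comp (chartChangeDeriv (c.chart j) (c'.chart j) x)
      = (chartChangeDeriv (c.chart i) (c'.chart i) (S.φ h x)).comp (S.ρ h) := by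
  have h1 : S.ρ h ∘ ((c'.chart j) ∘ (c.chart j).symm) =ᶠ[𝓝 (c.chart j x)]
      ((c'.chart i) ∘ (c.chart i).symm) ∘ S.ρ h := by
    filter_upwards [((c.chart j).symm.trans (c'.chart j)).open_source.mem_nhds
      (chart_mem_trans_source hx hx')] with y hy
    have hys := (c.chart j).map_target hy.1
    have h2 := c.comm i j h _ hys
    rw [(c.chart j).right_inv hy.1] at h2
    simp only [Function.comp_apply]
    rw [← h2, (c.chart i).left_inv (c.map_source i j h _ hys), c'.comm i j h ((c.chart j).symm y) hy.2]
  have h3 := h1.fderiv_eq (𝕜 := ℝ)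
  rw [fderiv_comp _ (S.ρ h).differentiableAt (differentiableAt_chart_change
    (c.mem_maximalAtlas j) (c'.mem_maximalAtlas j) hx hx')] at h3
  have h4 := differentiableAt_chart_change (c.mem_maximalAtlas i) (c'.mem_maximalAtlas i)
    (c.map_source i j h _ hx) (c'.map_source i j h _ hx')
  rw [c.comm i j h x hx] at h4
  rw [fderiv_comp _ h4 (S.ρ h).differentiableAt] at h3
  simpa [chartChangeDeriv, c.comm i j h x hx] using h3

open Classical in
/-- The cocycle `(D(ψ i ∘ (ψ' i)⁻¹) × D(ψ i ∘ (ψ' i)⁻¹))` with values in `H⁰(𝔽 × 𝔽)`. -/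
def transCocycle (c c' : S.LimitChart) (x : S.Lim) : S.H0 :=
  -- Off the overlap the value is never used; the unit of the group is a default.
  if h : x ∈ c.toChart.source ∩ c'.toChart.source then
    ⟨fun i => chartChangeUnit (c'.mem_maximalAtlas i) (c.mem_maximalAtlas i) (h.2 i) (h.1 i), by
      intro i j hij
      have h1 := chartChangeDeriv_compat c' c hij (h.2 j) (h.1 j)
      rw [x.2 i j hij] at h1
      ext z
      · simpa [chartChangeUnit] using DFunLike.congr_fun h1 z
      · simp [chartChangeUnit]
      · simp [chartChangeUnit]
      · simpa [chartChangeUnit] using DFunLike.congr_fun h1 z⟩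
  else 1

theorem hProj_transCocycle {c c' : S.LimitChart} {x : S.Lim}
    (h : x ∈ c.toChart.source ∩ c'.toChart.source) (i : ℕ) :
    S.hProj i (H0toH (transCocycle c c' x))
      = (chartChangeDeriv (c'.chart i) (c.chart i) (x.1 i)).prodMap
        (chartChangeDeriv (c'.chart i) (c.chart i) (x.1 i)) := by
  rw [transCocycle, dif_pos h]
  rfl

theorem limOp_transCocycle_fst {c c' : S.LimitChart} {x : S.Lim}
    (h : x ∈ c.toChart.source ∩ c'.toChart.source) (v : S.Model × S.Model) (i : ℕ) :
    (limOp (transCocycle c c' x) v).1.1 i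
      = chartChangeDeriv (c'.chart i) (c.chart i) (x.1 i) (v.1.1 i) :=
  congrArg (fun T => (T (v.1.1 i, v.2.1 i)).1) (hProj_transCocycle h i)

theorem limOp_transCocycle_snd {c c' : S.LimitChart} {x : S.Lim}
    (h : x ∈ c.toChart.source ∩ c'.toChart.source) (v : S.Model × S.Model) (i : ℕ) :
    (limOp (transCocycle c c' x) v).2.1 i
      = chartChangeDeriv (c'.chart i) (c.chart i) (x.1 i) (v.2.1 i) :=
  congrArg (fun T => (T (v.1.1 i, v.2.1 i)).2) (hProj_transCocycle h i)

theorem H0toH_injective : Function.Injective (H0toH (S := S)) := by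
  intro a b h
  refine Subtype.ext (funext fun i => Units.ext ?_)
  exact congrArg (fun l : S.H => l.1 i) h

theorem transCocycle_mul {c c' c'' : S.LimitChart} {x : S.Lim}
    (h : x ∈ c.toChart.source ∩ c'.toChart.source ∩ c''.toChart.source) :
    transCocycle c c' x * transCocycle c' c'' x = transCocycle c c'' x := by
  refine H0toH_injective (S.isClosedEmbedding_hProj.injective (funext fun i => ?_))
  have h1 := chartChangeDeriv_comp (c''.mem_maximalAtlas i) (c'.mem_maximalAtlas i)
    (c.mem_maximalAtlas i) (h.2 i) (h.1.2 i) (h.1.1 i)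
  have h2 : S.hProj i (H0toH (transCocycle c c' x * transCocycle c' c'' x))
      = (S.hProj i (H0toH (transCocycle c c' x))).comp
        (S.hProj i (H0toH (transCocycle c' c'' x))) := rfl
  simp only [h2, hProj_transCocycle ⟨h.1.1, h.1.2⟩, hProj_transCocycle ⟨h.1.2, h.2⟩,
    hProj_transCocycle ⟨h.1.1, h.2⟩]
  rw [← h1]
  rfl

theorem limOp_mul (a b : S.H0) (v : S.Model × S.Model) : limOp (a * b) v = limOp a (limOp b v) :=
  rfl

theorem limOp_one (v : S.Model × S.Model) : limOp (1 : S.H0) v = v := rfl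

/-- The cocycle identity makes this element idempotent, and the only idempotent of a group is 1. -/
theorem transCocycle_self {c : S.LimitChart} {x : S.Lim} (h : x ∈ c.toChart.source) :
    transCocycle c c x = 1 := by
  have := transCocycle_mul (c := c) (c' := c) (c'' := c) ⟨⟨h, h⟩, h⟩
  simpa using this

theorem continuousOn_transCocycle (c c' : S.LimitChart) :
    ContinuousOn (fun x => H0toH (transCocycle c c' x))
      (c.toChart.source ∩ c'.toChart.source) := by
  refine S.isClosedEmbedding_hProj.isInducing.continuousOn_iff.2 (continuousOn_pi.2 fun i => ?_)
  have h1 : ContinuousOn (fun x : S.Lim => chartChangeDeriv (c'.chart i) (c.chart i) (x.1 i))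
      (c.toChart.source ∩ c'.toChart.source) :=
    (continuousOn_chartChangeDeriv (c'.mem_maximalAtlas i) (c.mem_maximalAtlas i)).comp
      (continuous_lim_apply i).continuousOn fun x hx => ⟨hx.2 i, hx.1 i⟩
  exact ((ContinuousLinearMap.prodMapL ℝ (E i) (E i) (E i) (E i)).continuous.comp_continuousOn
    (h1.prodMk h1)).congr fun x hx => hProj_transCocycle hx i

/-- In a limit chart `b` the i-th component depends only on the i-th coordinate, so the levelwise
criterion applies with target H(𝔽 × 𝔽). -/
theorem smoothH0On_transCocycle (c c' : S.LimitChart) :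
    S.SmoothH0On (transCocycle c c') (c.toChart.source ∩ c'.toChart.source) := by
  refine ⟨continuousOn_transCocycle c c', ?_⟩
  rintro _ ⟨b, rfl⟩ _ rfl
  refine leslieSmoothOn_of_levels S.isClosedEmbedding_hProj S.modelProj ?_
    (fun i => (b.chart i).target ∩ (b.chart i).symm ⁻¹'
      ((c'.chart i).source ∩ (c.chart i).source))
    (fun i => (b.chart i).isOpen_inter_preimage_symm
      ((c'.chart i).open_source.inter (c.chart i).open_source))
    (fun i y => (chartChangeDeriv (c'.chart i) (c.chart i) ((b.chart i).symm y)).prodMap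
      (chartChangeDeriv (c'.chart i) (c.chart i) ((b.chart i).symm y))) (fun i => ?_) ?_ ?_
  · simp only [OpenPartialHomeomorph.refl_source, preimage_univ, inter_univ]
    exact b.toChart.isOpen_inter_preimage_symm
      (c.toChart.open_source.inter c'.toChart.open_source)
  · have h1 := contDiffOn_chartChangeDeriv (b.mem_maximalAtlas i) (c'.mem_maximalAtlas i)
      (c.mem_maximalAtlas i)
    exact (ContinuousLinearMap.prodMapL ℝ (E i) (E i) (E i) (E i)).contDiff.comp_contDiffOn
      (h1.prodMk h1)
  · rintro i y ⟨hy, ⟨hc, hc'⟩, -⟩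
    have h1 := b.toChart_symm_apply hy i
    refine ⟨hy i, ?_⟩
    have h2 := hc' i
    have h3 := hc i
    rw [h1] at h2 h3
    exact ⟨h2, h3⟩
  · rintro i y ⟨hy, hc, -⟩
    have h1 := hProj_transCocycle hc i
    rw [b.toChart_symm_apply hy i] at h1
    exact h1

/-- Maps which in local trivializations are given by the cocycle `transCocycle` are smooth. -/
theorem smoothMapOn_totalAtlas {X Y : Type*} [TopologicalSpace X] [TopologicalSpace Y]
    {π : X → S.Lim} {π' : Y → S.Lim}
    {t : S.LimitChart → Bundle.Trivialization (S.Model × S.Model) π}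
    {t' : S.LimitChart → Bundle.Trivialization (S.Model × S.Model) π'}
    (ht : ∀ c, (t c).baseSet = c.toChart.source) (ht' : ∀ c, (t' c).baseSet = c.toChart.source)
    {f : X → Y} (hf : Continuous f) (hπ : ∀ p, π' (f p) = π p)
    (hrep : ∀ c c', ∀ x ∈ c.toChart.source ∩ c'.toChart.source, ∀ v,
      t' c (f ((t c').toOpenPartialHomeomorph.symm (x, v)))
        = (x, limOp (transCocycle c c' x) v)) :
    SmoothMapOn (S.totalAtlas t) (S.totalAtlas t') f univ := by
  refine ⟨hf.continuousOn, ?_⟩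
  rintro e ⟨c', _, ⟨b, rfl⟩, rfl⟩ e' ⟨c, _, ⟨b', rfl⟩, rfl⟩
  set e := (t c').toOpenPartialHomeomorph.trans
    (b.toChart.prod (OpenPartialHomeomorph.refl (S.Model × S.Model))) with he
  set e' := (t' c).toOpenPartialHomeomorph.trans
    (b'.toChart.prod (OpenPartialHomeomorph.refl (S.Model × S.Model))) with he'
  -- In charts the map is (y, v) ↦ (b'(b⁻¹ y), T(b⁻¹ y) v) with T the cocycle; both components are
  -- levelwise.
  have key : ∀ z ∈ e.target ∩ e.symm ⁻¹' (univ ∩ f ⁻¹' e'.source),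
      z.1 ∈ b.toChart.target ∧ b.toChart.symm z.1 ∈ c.toChart.source ∩ c'.toChart.source ∧
      b.toChart.symm z.1 ∈ b'.toChart.source ∧
      (e' ∘ f ∘ e.symm) z = (b'.toChart (b.toChart.symm z.1),
        limOp (transCocycle c c' (b.toChart.symm z.1)) z.2) := by
    rintro z ⟨hz, -, hz'⟩
    have h1 : z.1 ∈ b.toChart.target := hz.1.1
    have h2 : (b.toChart.symm z.1, z.2) ∈ (t c').target := hz.2
    have h2' : b.toChart.symm z.1 ∈ c'.toChart.source := by
      rw [(t c').mem_target, ht] at h2; exact h2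
    have h3 : f ((t c').toOpenPartialHomeomorph.symm (b.toChart.symm z.1, z.2))
        ∈ (t' c).source := hz'.1
    have h3' : b.toChart.symm z.1 ∈ c.toChart.source := by
      rw [(t' c).mem_source, hπ, (t c').proj_symm_apply h2, ht'] at h3; exact h3
    have h4 := hrep c c' _ ⟨h3', h2'⟩ z.2
    have h5 : t' c (f ((t c').toOpenPartialHomeomorph.symm (b.toChart.symm z.1, z.2)))
        ∈ b'.toChart.source ×ˢ univ := hz'.2
    rw [h4] at h5
    refine ⟨h1, ⟨h3', h2'⟩, h5.1, ?_⟩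
    exact congrArg (b'.toChart.prod (OpenPartialHomeomorph.refl (S.Model × S.Model))) h4
  refine leslieSmoothOn_of_levels S.isClosedEmbedding_totalProj S.totalProj ?_
    (fun i => Prod.fst ⁻¹' ((b.chart i).target ∩ (b.chart i).symm ⁻¹'
      (((c'.chart i).source ∩ (c.chart i).source) ∩ (b'.chart i).source)))
    (fun i => ((b.chart i).isOpen_inter_preimage_symm
      (((c'.chart i).open_source.inter (c.chart i).open_source).inter
        (b'.chart i).open_source)).preimage continuous_fst)
    (fun i z => (b'.chart i ((b.chart i).symm z.1),
      (chartChangeDeriv (c'.chart i) (c.chart i) ((b.chart i).symm z.1) z.2.1,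
       chartChangeDeriv (c'.chart i) (c.chart i) ((b.chart i).symm z.1) z.2.2)))
    (fun i => ?_) ?_ ?_
  · rw [univ_inter]
    exact e.isOpen_inter_preimage_symm ((OpenPartialHomeomorph.open_source e').preimage hf)
  · have h1 := (contDiffOn_chartChangeDeriv (b.mem_maximalAtlas i) (c'.mem_maximalAtlas i)
      (c.mem_maximalAtlas i)).comp (contDiffOn_fst (F := E i × E i)
        (s := Prod.fst ⁻¹' ((b.chart i).target ∩ (b.chart i).symm ⁻¹'
      (((c'.chart i).source ∩ (c.chart i).source) ∩ (b'.chart i).source))))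
        fun z hz => ⟨hz.1, hz.2.1⟩
    refine ContDiffOn.prodMk ?_ (ContDiffOn.prodMk ?_ ?_)
    · exact (contDiffOn_chart_change (b.mem_maximalAtlas i) (b'.mem_maximalAtlas i)).comp
        contDiffOn_fst fun z hz => ⟨hz.1, hz.2.2⟩
    · exact h1.clm_apply contDiff_snd.fst.contDiffOn
    · exact h1.clm_apply contDiff_snd.snd.contDiffOn
  · intro i z hz
    obtain ⟨h1, h2, h3, -⟩ := key z hz
    have h4 := b.toChart_symm_apply h1 i
    have h5 := h2.1 i
    have h6 := h2.2 i
    have h7 := h3 i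
    rw [h4] at h5 h6 h7
    exact ⟨h1 i, ⟨h6, h5⟩, h7⟩
  · intro i z hz
    obtain ⟨h1, h2, h3, h4⟩ := key z hz
    have h5 := b.toChart_symm_apply h1 i
    rw [h4]
    refine Prod.ext ?_ (Prod.ext ?_ ?_)
    · exact (b'.toChart_apply h3 i).trans (congrArg (b'.chart i) h5)
    · exact (limOp_transCocycle_fst h2 z.2 i).trans (by rw [h5]; rfl)
    · exact (limOp_transCocycle_snd h2 z.2 i).trans (by rw [h5]; rfl)

theorem isSmoothAtlas_limitAtlas (hcover : ∀ x : S.Lim, ∃ c : S.LimitChart, x ∈ c.toChart.source) :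
    IsSmoothAtlas S.limitAtlas := by
  refine ⟨fun x => ?_, ?_⟩
  · obtain ⟨c, hc⟩ := hcover x
    exact ⟨_, ⟨c, rfl⟩, hc⟩
  · rintro _ ⟨b, rfl⟩ _ ⟨b', rfl⟩
    refine leslieSmoothOn_of_levels S.isClosedEmbedding_modelProj S.modelProj
      (b.toChart.symm.trans b'.toChart).open_source
      (fun i => ((b.chart i).symm.trans (b'.chart i)).source)
      (fun i => ((b.chart i).symm.trans (b'.chart i)).open_source)
      (fun i => b'.chart i ∘ (b.chart i).symm)
      (fun i => contDiffOn_chart_change (b.mem_maximalAtlas i) (b'.mem_maximalAtlas i)) ?_ ?_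
    · rintro i y ⟨hy, hy'⟩
      have h1 : (b.toChart.symm y).1 i ∈ (b'.chart i).source := hy' i
      rw [b.toChart_symm_apply hy i] at h1
      exact ⟨hy i, h1⟩
    · rintro i y ⟨hy, hy'⟩
      exact (b'.toChart_apply hy' i).trans (congrArg (b'.chart i) (b.toChart_symm_apply hy i))

/-- Joint continuity in the operator and the vector can be checked on each level, where it is
continuity of evaluation of Banach space operators in the norm topology. This is what using H
instead of L(𝔽 × 𝔽) provides. -/
theorem continuousOn_limOp {T : S.Lim → S.H0} {s : Set S.Lim}
    (hT : ContinuousOn (fun x => H0toH (T x)) s) :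
    ContinuousOn (fun p : S.Lim × (S.Model × S.Model) => limOp (T p.1) p.2) (s ×ˢ univ) := by
  have h (i : ℕ) : ContinuousOn (fun p : S.Lim × (S.Model × S.Model) =>
      S.hProj i (H0toH (T p.1)) (S.modelProj i p.2.1, S.modelProj i p.2.2)) (s ×ˢ univ) := by
    have h1 : ContinuousOn (fun p : S.Lim × (S.Model × S.Model) => S.hProj i (H0toH (T p.1)))
        (s ×ˢ univ) :=
      (S.hProj i).continuous.comp_continuousOn (hT.comp continuousOn_fst fun p hp => hp.1)
    have h2 : Continuous (fun p : S.Lim × (S.Model × S.Model) =>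
        (S.modelProj i p.2.1, S.modelProj i p.2.2)) :=
      ((S.modelProj i).continuous.comp continuous_snd.fst).prodMk
        ((S.modelProj i).continuous.comp continuous_snd.snd)
    exact h1.clm_apply h2.continuousOn
  refine ContinuousOn.prodMk ?_ ?_
  · exact S.isClosedEmbedding_modelProj.isInducing.continuousOn_iff.2
      (continuousOn_pi.2 fun i => (h i).fst)
  · exact S.isClosedEmbedding_modelProj.isInducing.continuousOn_iff.2
      (continuousOn_pi.2 fun i => (h i).snd)

/-! ### The vector bundles with cocycle `transCocycle` -/

/-- The bundle over `M` with fibre `𝔽 × 𝔽` glued by the cocycle `transCocycle`. -/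
def cocycleCore (hcover : ∀ x : S.Lim, ∃ c : S.LimitChart, x ∈ c.toChart.source) :
    FiberBundleCore S.LimitChart S.Lim (S.Model × S.Model) where
  baseSet c := c.toChart.source
  isOpen_baseSet c := c.toChart.open_source
  indexAt x := (hcover x).choose
  mem_baseSet_at x := (hcover x).choose_spec
  -- The order is reversed: a coordinate change goes from the first index to the second, while
  -- `transCocycle` lists the target chart first.
  coordChange c c' x v := limOp (transCocycle c' c x) v
  coordChange_self c x hx v := by rw [transCocycle_self hx, limOp_one]
  continuousOn_coordChange c c' := by
    rw [inter_comm]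
    exact continuousOn_limOp (continuousOn_transCocycle c' c)
  coordChange_comp c c' c'' x hx v := by
    rw [← limOp_mul, transCocycle_mul ⟨⟨hx.2, hx.1.2⟩, hx.1.1⟩]

section Transport

variable {hcover : ∀ x : S.Lim, ∃ c : S.LimitChart, x ∈ c.toChart.source}
  {X : Type*} [TopologicalSpace X] (h : X ≃ₜ (cocycleCore hcover).TotalSpace)

/-- The trivializations of a space which is homeomorphic to the bundle `cocycleCore`. -/
def cocycleTriv (c : S.LimitChart) :
    Bundle.Trivialization (S.Model × S.Model) ((cocycleCore hcover).proj ∘ h) :=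
  ((cocycleCore hcover).localTriv c).compHomeomorph h

/-- With `h' = h` this computes the transition functions of one bundle, and with different
homeomorphisms the local form of the isomorphism between two realizations; both are the same
cocycle. -/
theorem cocycleTriv_symm_apply {Y : Type*} [TopologicalSpace Y]
    (h' : Y ≃ₜ (cocycleCore hcover).TotalSpace) {c c' : S.LimitChart} {x : S.Lim}
    (hx : x ∈ c.toChart.source ∩ c'.toChart.source) (v : S.Model × S.Model) :
    cocycleTriv h' c (h'.symm (h ((cocycleTriv h c').toOpenPartialHomeomorph.symm (x, v))))
      = (x, limOp (transCocycle c c' x) v) := by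
  have h1 : h ((cocycleTriv h c').toOpenPartialHomeomorph.symm (x, v))
      = ((cocycleCore hcover).localTriv c').toOpenPartialHomeomorph.symm (x, v) :=
    h.apply_symm_apply _
  have h2 (p : (cocycleCore hcover).TotalSpace) : cocycleTriv h' c (h'.symm p) = (cocycleCore hcover).localTriv c p :=
    congrArg ((cocycleCore hcover).localTriv c) (h'.apply_symm_apply p)
  rw [h1, h2, (cocycleCore hcover).localTriv_symm_apply, (cocycleCore hcover).localTriv_apply]
  exact Prod.ext rfl ((cocycleCore hcover).coordChange_comp c' ((cocycleCore hcover).indexAt x) c x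
    ⟨⟨hx.2, (cocycleCore hcover).mem_baseSet_at x⟩, hx.1⟩ v)

/-- The `H⁰(𝔽 × 𝔽)`-vector bundle on a space which is homeomorphic to `cocycleCore`. -/
def cocycleBundle : S.H0VectorBundle S.LimitChart ((cocycleCore hcover).proj ∘ h) where
  triv := cocycleTriv h
  cover := hcover
  base_atlas := isSmoothAtlas_limitAtlas hcover
  total_atlas := by
    -- Smoothness of the identity of the total space is smoothness of its changes of charts.
    have hid := smoothMapOn_totalAtlas (t := cocycleTriv h) (t' := cocycleTriv h)
      (fun _ => rfl) (fun _ => rfl) continuous_id (fun _ => rfl) (fun c c' x hx v => by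
        have := cocycleTriv_symm_apply h h hx v
        rwa [h.symm_apply_apply] at this)
    refine ⟨fun p => ?_, fun e he e' he' => ?_⟩
    · obtain ⟨c, hc⟩ := hcover ((cocycleCore hcover).proj (h p))
      refine ⟨_, ⟨c, _, ⟨c, rfl⟩, rfl⟩, ?_⟩
      have hs : p ∈ (cocycleTriv h c).source := (cocycleTriv h c).mem_source.2 hc
      refine ⟨hs, ?_, mem_univ _⟩
      change (cocycleTriv h c p).1 ∈ c.toChart.source
      rw [(cocycleTriv h c).coe_fst hs]
      exact hc
    · have := hid.2 e he e' he'
      rw [univ_inter] at this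
      exact this
  trans := transCocycle
  trans_smooth := smoothH0On_transCocycle
  trans_spec c c' x hx v := by
    have := cocycleTriv_symm_apply h h hx v
    rwa [h.symm_apply_apply] at this
  cocycle _ _ _ _ hx := transCocycle_mul hx

/-- The isomorphism of two realizations of the bundle with cocycle `transCocycle`. -/
def cocycleBundleIso {Y : Type*} [TopologicalSpace Y]
    (h' : Y ≃ₜ (cocycleCore hcover).TotalSpace) :
    S.H0VectorBundleIso (cocycleBundle h) (cocycleBundle h') where
  toEquiv := (h.trans h'.symm).toEquiv
  proj_comp p := congrArg (cocycleCore hcover).proj (h'.apply_symm_apply (h p))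
  smooth := smoothMapOn_totalAtlas (fun _ => rfl) (fun _ => rfl) (h.trans h'.symm).continuous
    (fun p => congrArg (cocycleCore hcover).proj (h'.apply_symm_apply (h p)))
    fun _ _ _ hx v => cocycleTriv_symm_apply h h' hx v
  smooth_symm := smoothMapOn_totalAtlas (fun _ => rfl) (fun _ => rfl)
    (h'.trans h.symm).continuous
    (fun p => congrArg (cocycleCore hcover).proj (h.apply_symm_apply (h' p)))
    fun _ _ _ hx v => cocycleTriv_symm_apply h' h hx v
  -- The isomorphism is represented by the cocycle of both bundles, so its two intertwining
  -- relations are the cocycle identity.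
  rep := transCocycle
  rep_smooth := smoothH0On_transCocycle
  rep_spec _ _ _ hx v := cocycleTriv_symm_apply h h' hx v
  rep_trans _ _ _ _ hx := transCocycle_mul hx
  trans_rep _ _ _ _ hx := transCocycle_mul hx

end Transport

end ProjSystem

/-! ### Second-order chain rule for curves -/

section CurveCalculus

variable {E F : Type*} [NormedAddCommGroup E] [NormedSpace ℝ E]
  [NormedAddCommGroup F] [NormedSpace ℝ F]

/-- The first two derivatives of the image of a curve. -/
theorem derivs_of_eventuallyEq_comp {τ : E → F} {O : Set E} (hO : IsOpen O)
    (hτ : ContDiffOn ℝ ∞ τ O) {γ d : ℝ → E} {a : E} {γ' d' : ℝ → F} {a' : F} (h0 : γ 0 ∈ O)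
    (hγ : ∀ᶠ t in 𝓝 0, HasDerivAt γ (d t) t) (hd : HasDerivAt d a 0)
    (hγ' : ∀ᶠ t in 𝓝 0, HasDerivAt γ' (d' t) t) (hd' : HasDerivAt d' a' 0)
    (heq : γ' =ᶠ[𝓝 0] τ ∘ γ) :
    d' 0 = fderiv ℝ τ (γ 0) (d 0) ∧
      a' = fderiv ℝ (fderiv ℝ τ) (γ 0) (d 0) (d 0) + fderiv ℝ τ (γ 0) a := by
  have hmem : ∀ᶠ t in 𝓝 0, γ t ∈ O :=
    hγ.self_of_nhds.continuousAt.eventually (hO.mem_nhds h0)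
  have hd_eq : d' =ᶠ[𝓝 0] fun t => fderiv ℝ τ (γ t) (d t) := by
    filter_upwards [hγ, hγ', hmem, heq.eventuallyEq_nhds] with t h1 h2 h3 h4
    have h5 := ((hτ.contDiffAt (hO.mem_nhds h3)).differentiableAt (by simp)).hasFDerivAt
    exact (h2.congr_of_eventuallyEq h4.symm).unique (h5.comp_hasDerivAt t h1)
  refine ⟨hd_eq.self_of_nhds, ?_⟩
  have h6 : HasFDerivAt (fderiv ℝ τ) (fderiv ℝ (fderiv ℝ τ) (γ 0)) (γ 0) :=
    ((((contDiffOn_infty_iff_fderiv_of_isOpen hO).1 hτ).2.contDiffAt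
      (hO.mem_nhds h0)).differentiableAt (by simp)).hasFDerivAt
  have h7 := (h6.comp_hasDerivAt 0 hγ.self_of_nhds).clm_apply hd
  exact hd'.unique (h7.congr_of_eventuallyEq hd_eq)

end CurveCalculus

namespace ProjSystem

variable {E : ℕ → Type u} [∀ i, NormedAddCommGroup (E i)] [∀ i, NormedSpace ℝ (E i)]
variable {M : ℕ → Type v} [∀ i, TopologicalSpace (M i)] [∀ i, ChartedSpace (E i) (M i)]
variable {S : ProjSystem E M}

/-! ### Velocity and acceleration of curves -/

theorem Curve.eventually_mem_source {x : S.Lim} (f : S.Curve x) {c : S.LimitChart}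
    (hx : x ∈ c.toChart.source) : ∀ᶠ t in 𝓝 0, f.1 t ∈ c.toChart.source := by
  obtain ⟨f, rfl, ε, hε, hcont, -⟩ := f
  have h0 : (0 : ℝ) ∈ Ioo (-ε) ε := by simp [hε]
  exact (hcont.continuousAt (isOpen_Ioo.mem_nhds h0)).eventually
    (c.toChart.open_source.mem_nhds hx)

/-- The velocity and the acceleration of a curve are computed levelwise. -/
theorem Curve.exists_hasDerivAt {x : S.Lim} (f : S.Curve x) {c : S.LimitChart}
    (hx : x ∈ c.toChart.source) :
    ∃ d : ℝ → S.Model, d 0 = f.vel c ∧ ∀ i,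
      (∀ᶠ t in 𝓝 0, HasDerivAt (fun s => c.chart i ((f.1 s).1 i)) ((d t).1 i) t) ∧
      HasDerivAt (fun s => (d s).1 i) ((f.acc c).1 i) 0 := by
  obtain ⟨ε, hε, hcont, hsm⟩ := f.2.2
  set U := Ioo (-ε) ε ∩ f.1 ⁻¹' c.toChart.source with hUdef
  have hU : IsOpen U := hcont.isOpen_inter_preimage isOpen_Ioo c.toChart.open_source
  have h0 : (0 : ℝ) ∈ U := ⟨by simp [hε], by rw [mem_preimage, f.2.1]; exact hx⟩
  have h2 : LeslieC 2 ℝ (c.toChart ∘ f.1) U := by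
    have := hsm (OpenPartialHomeomorph.refl ℝ) rfl c.toChart ⟨c, rfl⟩ 2
    simpa using this
  obtain ⟨d, hd, hdd⟩ := exists_slopes_of_leslieC_two h2
  obtain ⟨a, ha⟩ := hdd 0 h0
  have hcd : ∀ t ∈ U, curveDeriv (c.toChart ∘ f.1) t = d t := fun t ht =>
    curveDeriv_eq_of_tendsto (hd t ht)
  -- The iterated `curveDeriv` is known to equal the slope limit `d` only on `U`, which suffices for
  -- the limit at 0.
  have hacc : f.acc c = a := by
    refine curveDeriv_eq_of_tendsto (ha.congr' ?_)
    filter_upwards [nhdsWithin_le_nhds (hU.mem_nhds h0)] with t ht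
    rw [zero_add, hcd t ht, hcd 0 h0]
  have hlevel {g : ℝ → S.Model} {t : ℝ} {b : S.Model}
      (h : Tendsto (fun h : ℝ => h⁻¹ • (g (t + h) - g t)) (𝓝[≠] 0) (𝓝 b)) (i : ℕ) :
      HasDerivAt (fun s => (g s).1 i) (b.1 i) t :=
    hasDerivAt_iff_tendsto_slope_zero.2 (((S.modelProj i).continuous.tendsto b).comp h)
  refine ⟨d, (hcd 0 h0).symm, fun i => ⟨?_, hacc ▸ hlevel ha i⟩⟩
  filter_upwards [hU.mem_nhds h0] with t ht
  refine (hlevel (hd t ht) i).congr_of_eventuallyEq ?_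
  filter_upwards [hU.mem_nhds ht] with s hs
  exact (c.toChart_apply hs.2 i).symm

/-- The second-order chain rule on level i. The term with D²τ depends only on the velocity, so
agreement up to acceleration in one chart implies agreement in all. -/
theorem Curve.derivs_chart_change {x : S.Lim} (f : S.Curve x) {c c' : S.LimitChart}
    (hx : x ∈ c.toChart.source) (hx' : x ∈ c'.toChart.source) (i : ℕ) :
    (f.vel c').1 i = chartChangeDeriv (c.chart i) (c'.chart i) (x.1 i) ((f.vel c).1 i) ∧
    (f.acc c').1 i = fderiv ℝ (fderiv ℝ (c'.chart i ∘ (c.chart i).symm)) (c.chart i (x.1 i))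
        ((f.vel c).1 i) ((f.vel c).1 i)
      + chartChangeDeriv (c.chart i) (c'.chart i) (x.1 i) ((f.acc c).1 i) := by
  obtain ⟨d, hd0, hd⟩ := f.exists_hasDerivAt hx
  obtain ⟨d', hd0', hd'⟩ := f.exists_hasDerivAt hx'
  have hf0 : f.1 0 = x := f.2.1
  have h := derivs_of_eventuallyEq_comp ((c.chart i).symm.trans (c'.chart i)).open_source
    (contDiffOn_chart_change (c.mem_maximalAtlas i) (c'.mem_maximalAtlas i))
    (by rw [hf0]; exact chart_mem_trans_source (hx i) (hx' i))
    (hd i).1 (hd i).2 (hd' i).1 (hd' i).2 (by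
      filter_upwards [f.eventually_mem_source hx] with t ht
      exact congrArg (c'.chart i) ((c.chart i).left_inv (ht i)).symm)
  rw [hf0, hd0, hd0'] at h
  exact h

/-- Curves with prescribed velocity and acceleration in a limit chart. -/
theorem exists_curve {x : S.Lim} {c : S.LimitChart} (hx : x ∈ c.toChart.source)
    (u w : S.Model) : ∃ f : S.Curve x, f.vel c = u ∧ f.acc c = w := by
  set y := c.toChart x with hy
  -- A parabola in the chart; the factor 1/2 makes its second derivative `w`.
  set P : ℝ → S.Model := fun t => y + t • u + (t ^ 2 / 2) • w with hP
  have hPc : Continuous P := by fun_prop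
  have hP0 : P 0 = y := by simp [hP]
  have hev : ∀ᶠ t in 𝓝 0, P t ∈ c.toChart.target :=
    hPc.continuousAt.eventually (c.toChart.open_target.mem_nhds
      (by rw [hP0]; exact c.toChart.map_source hx))
  obtain ⟨ε, hε, hball⟩ := Metric.eventually_nhds_iff_ball.1 hev
  rw [Real.ball_eq_Ioo, zero_sub, zero_add] at hball
  have hcont : ContinuousOn (fun t => c.toChart.symm (P t)) (Ioo (-ε) ε) :=
    c.toChart.continuousOn_symm.comp hPc.continuousOn hball
  have hPi (i : ℕ) (t : ℝ) : (P t).1 i = y.1 i + t • u.1 i + (t ^ 2 / 2) • w.1 i := rfl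
  have hPs (i : ℕ) : ContDiff ℝ ∞ fun t => (P t).1 i := by
    simp only [hPi]
    fun_prop
  let f : S.Curve x := ⟨fun t => c.toChart.symm (P t),
    by change c.toChart.symm (P 0) = x; rw [hP0, hy, c.toChart.left_inv hx], ε, hε, hcont, by
      rintro _ rfl _ ⟨b, rfl⟩
      -- The levelwise criterion with the domain ℝ on every level.
      refine leslieSmoothOn_of_levels S.isClosedEmbedding_modelProj
        (A := fun _ => ℝ) (fun _ => ContinuousLinearMap.id ℝ ℝ) ?_
        (fun i => (fun t => (P t).1 i) ⁻¹' ((c.chart i).symm.trans (b.chart i)).source)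
        (fun i => ((c.chart i).symm.trans (b.chart i)).open_source.preimage (hPs i).continuous)
        (fun i => (b.chart i ∘ (c.chart i).symm) ∘ fun t => (P t).1 i)
        (fun i => (contDiffOn_chart_change (c.mem_maximalAtlas i) (b.mem_maximalAtlas i)).comp
          (hPs i).contDiffOn fun t ht => ht) ?_ ?_
      · simpa using hcont.isOpen_inter_preimage isOpen_Ioo b.toChart.open_source
      · rintro i t ⟨-, ht, ht'⟩
        have h1 : (c.toChart.symm (P t)).1 i ∈ (b.chart i).source := ht' i
        rw [c.toChart_symm_apply (hball t ht) i] at h1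
        exact ⟨hball t ht i, h1⟩
      · rintro i t ⟨-, ht, ht'⟩
        exact (b.toChart_apply ht' i).trans
          (congrArg (b.chart i) (c.toChart_symm_apply (hball t ht) i))⟩
  obtain ⟨d, hd0, hd⟩ := f.exists_hasDerivAt hx
  have hdP (i : ℕ) : (fun t => (d t).1 i) =ᶠ[𝓝 0] fun t => u.1 i + t • w.1 i := by
    filter_upwards [(hd i).1, hev.eventually_nhds] with t ht hPt
    have h1 : HasDerivAt (fun t => (P t).1 i) (u.1 i + t • w.1 i) t := by
      simp only [hPi]
      have h2 : HasDerivAt (fun t : ℝ => t • u.1 i) (u.1 i) t := by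
        simpa using (hasDerivAt_id t).smul_const (u.1 i)
      have h3 : HasDerivAt (fun t : ℝ => (t ^ 2 / 2) • w.1 i) (t • w.1 i) t := by
        have h4 : HasDerivAt (fun t : ℝ => t ^ 2 / 2) t t := by
          simpa using ((hasDerivAt_pow 2 t).div_const 2)
        exact h4.smul_const (w.1 i)
      exact (h2.const_add (y.1 i)).add h3
    refine ht.unique (h1.congr_of_eventuallyEq ?_)
    filter_upwards [hPt] with s hs
    exact (congrArg (c.chart i) (c.toChart_symm_apply hs i)).trans ((c.chart i).right_inv (hs i))
  refine ⟨f, model_ext fun i => ?_, model_ext fun i => ?_⟩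
  · rw [← hd0]
    simpa using (hdP i).self_of_nhds
  · have h1 : HasDerivAt (fun t : ℝ => u.1 i + t • w.1 i) (w.1 i) 0 := by
      simpa using ((hasDerivAt_id (0 : ℝ)).smul_const (w.1 i)).const_add (u.1 i)
    exact (hd i).2.unique (h1.congr_of_eventuallyEq (hdP i))

/-! ### Coordinates on the fibres of `TM` and `T²M` -/

/-- The coordinate `[f, x] ↦ (ψ ∘ f)'(0)` on `T_x M`. -/
def velEquiv (c : S.LimitChart) {x : S.Lim} (hx : x ∈ c.toChart.source) :
    S.TangentSp x ≃ S.Model :=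
  Equiv.ofBijective (Quotient.lift (fun f : S.Curve x => f.vel c) fun _ _ h => h c hx) <| by
    refine ⟨?_, fun u => ?_⟩
    -- Equivalence demands equal velocities in all limit charts around x; the transformation law
    -- reduces this to `c`.
    · rintro ⟨f⟩ ⟨g⟩ (h : f.vel c = g.vel c)
      refine Quotient.sound fun c' hx' => model_ext fun i => ?_
      rw [(f.derivs_chart_change hx hx' i).1, (g.derivs_chart_change hx hx' i).1, h]
    · obtain ⟨f, hf, -⟩ := exists_curve hx u 0
      exact ⟨Quotient.mk _ f, hf⟩

theorem limOp_transCocycle_vel {c c' : S.LimitChart} {x : S.Lim}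
    (hx : x ∈ c.toChart.source) (hx' : x ∈ c'.toChart.source) (f g : S.Curve x) :
    limOp (transCocycle c' c x) (f.vel c, g.vel c) = (f.vel c', g.vel c') := by
  refine Prod.ext (model_ext fun i => ?_) (model_ext fun i => ?_)
  · rw [limOp_transCocycle_fst ⟨hx', hx⟩, (f.derivs_chart_change hx hx' i).1]
  · rw [limOp_transCocycle_snd ⟨hx', hx⟩, (g.derivs_chart_change hx hx' i).1]

/-- A family of sets with coordinates in `𝔽 × 𝔽`, as a realization of the bundle `cocycleCore`. -/
def fiberEquiv (hcover : ∀ x : S.Lim, ∃ c : S.LimitChart, x ∈ c.toChart.source)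
    {Fib : S.Lim → Type*} (κ : ∀ x, Fib x ≃ S.Model × S.Model) :
    (Σ x, Fib x) ≃ (cocycleCore hcover).TotalSpace where
  toFun p := ⟨p.1, κ p.1 p.2⟩
  invFun q := ⟨q.1, (κ q.1).symm q.2⟩
  left_inv p := by simp
  right_inv q := Bundle.TotalSpace.ext rfl (heq_of_eq ((κ q.1).apply_symm_apply q.2))

variable [∀ i, IsManifold 𝓘(ℝ, E i) ∞ (M i)]

/-- The quadratic term `Γ_ψ(ψ x)(u)(u)` of the limit connection. -/
def LimitConnection.quad (D : S.LimitConnection) (c : S.LimitChart) {x : S.Lim}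
    (hx : x ∈ c.toChart.source) (u : S.Model) : S.Model :=
  ⟨fun i => (D.conn i).christoffel (c.chart i) (c.chart i (x.1 i)) (u.1 i) (u.1 i), by
    intro i j h
    have h1 := LinearConnection.christoffel_related (S.φ_smooth h) (c.mem_maximalAtlas j)
      (c.mem_maximalAtlas i) (c.map_source i j h) (c.comm i j h) (D.conn j) (D.conn i)
      (D.compat i j h) ((c.chart j).map_source (hx j)) (u.1 j) (u.1 j)
    rw [← c.comm i j h _ (hx j), x.2 i j h, u.2 i j h] at h1
    exact h1⟩

/-- The coordinate `[f, x]₂ ↦ ((ψ ∘ f)'(0), (ψ ∘ f)''(0) + Γ_ψ(ψ x)((ψ ∘ f)'(0))((ψ ∘ f)'(0)))`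
on `T²_x M`. -/
def accEquiv (D : S.LimitConnection) (c : S.LimitChart) {x : S.Lim}
    (hx : x ∈ c.toChart.source) : S.TangentSp2 x ≃ S.Model × S.Model :=
  Equiv.ofBijective (Quotient.lift
      (fun f : S.Curve x => (f.vel c, f.acc c + D.quad c hx (f.vel c)))
      fun _ _ h => by simp only [(h c hx).1, (h c hx).2]) <| by
    refine ⟨?_, fun v => ?_⟩
    · rintro ⟨f⟩ ⟨g⟩ h
      have h1 : f.vel c = g.vel c := congrArg Prod.fst h
      have h2 : f.acc c + D.quad c hx (f.vel c) = g.acc c + D.quad c hx (g.vel c) :=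
        congrArg Prod.snd h
      rw [h1, add_left_inj] at h2
      refine Quotient.sound fun c' hx' => ⟨model_ext fun i => ?_, model_ext fun i => ?_⟩
      · rw [(f.derivs_chart_change hx hx' i).1, (g.derivs_chart_change hx hx' i).1, h1]
      · rw [(f.derivs_chart_change hx hx' i).2, (g.derivs_chart_change hx hx' i).2, h1, h2]
    -- Subtracting the quadratic term from the prescribed acceleration inverts the correction.
    · obtain ⟨f, hf, hf'⟩ := exists_curve hx v.1 (v.2 - D.quad c hx v.1)
      exact ⟨Quotient.mk _ f, Prod.ext hf (by simp [hf, hf'])⟩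

/-- The coordinates on `T²_x M` transform by the cocycle of the tangent bundle. -/
theorem limOp_transCocycle_acc (D : S.LimitConnection) {c c' : S.LimitChart} {x : S.Lim}
    (hx : x ∈ c.toChart.source) (hx' : x ∈ c'.toChart.source) (f : S.Curve x) :
    limOp (transCocycle c' c x) (f.vel c, f.acc c + D.quad c hx (f.vel c))
      = (f.vel c', f.acc c' + D.quad c' hx' (f.vel c')) := by
  refine Prod.ext (model_ext fun i => ?_) (model_ext fun i => ?_)
  · rw [limOp_transCocycle_fst ⟨hx', hx⟩, (f.derivs_chart_change hx hx' i).1]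
  · rw [limOp_transCocycle_snd ⟨hx', hx⟩]
    obtain ⟨h1, h2⟩ := f.derivs_chart_change hx hx' i
    have h3 := (D.conn i).christoffel_chart_change (c.mem_maximalAtlas i)
      (c'.mem_maximalAtlas i) (chart_mem_trans_source (hx i) (hx' i))
      ((f.vel c).1 i) ((f.vel c).1 i)
    rw [(c.chart i).left_inv (hx i)] at h3
    change chartChangeDeriv (c.chart i) (c'.chart i) (x.1 i) ((f.acc c).1 i
        + (D.conn i).christoffel (c.chart i) (c.chart i (x.1 i)) ((f.vel c).1 i) ((f.vel c).1 i))
      = (f.acc c').1 i + (D.conn i).christoffel (c'.chart i) (c'.chart i (x.1 i))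
        ((f.vel c').1 i) ((f.vel c').1 i)
    -- The term D²τ(v)(v) in the new acceleration, together with the new Christoffel term, is Dτ of
    -- the old Christoffel term.
    rw [map_add, h1, h2, add_right_comm, add_comm]
    exact congrArg (· + _) h3.symm

end ProjSystem

end FrechetT2

end

/-! ### Transport of the glued bundle to T²M and TM × TM -/

theorem theorem3p2
    (E : ℕ → Type u) [∀ i, NormedAddCommGroup (E i)] [∀ i, NormedSpace ℝ (E i)]
    [∀ i, CompleteSpace (E i)]
    (M : ℕ → Type v) [∀ i, TopologicalSpace (M i)] [∀ i, ChartedSpace (E i) (M i)]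
    [∀ i, IsManifold 𝓘(ℝ, E i) ∞ (M i)]
    (S : FrechetT2.ProjSystem E M)
    (hcover : ∀ x : S.Lim, ∃ c : S.LimitChart, x ∈ c.toChart.source)
    (D : S.LimitConnection) :
    ∃ (_ : TopologicalSpace S.T2M) (_ : TopologicalSpace S.TMTM)
      (B : S.H0VectorBundle S.LimitChart (FrechetT2.ProjSystem.T2M.proj S))
      (B' : S.H0VectorBundle S.LimitChart (FrechetT2.ProjSystem.TMTM.proj S)),
      (∀ c : S.LimitChart, (B.triv c).baseSet = c.toChart.source ∧
        ∀ x ∈ c.toChart.source, ∀ f : S.Curve x,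
          (B.triv c (FrechetT2.ProjSystem.T2M.mk f)).1 = x ∧
          (B.triv c (FrechetT2.ProjSystem.T2M.mk f)).2.1 = f.vel c ∧
          ∀ i, (B.triv c (FrechetT2.ProjSystem.T2M.mk f)).2.2.1 i = (f.acc c).1 i +
            (D.conn i).christoffel (c.chart i) (c.chart i (x.1 i))
              ((f.vel c).1 i) ((f.vel c).1 i)) ∧
      (∀ c : S.LimitChart, (B'.triv c).baseSet = c.toChart.source ∧
        ∀ x ∈ c.toChart.source, ∀ f g : S.Curve x,
          B'.triv c (FrechetT2.ProjSystem.TMTM.mk f g) = (x, (f.vel c, g.vel c))) ∧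
      Nonempty (S.H0VectorBundleIso B B') := by
  -- The fibre of `cocycleCore` at x is read in its preferred chart `indexAt x`; the same choice is
  -- made here.
  let idx (x : S.Lim) : S.LimitChart := (hcover x).choose
  have hidx (x : S.Lim) : x ∈ (idx x).toChart.source := (hcover x).choose_spec
  let h₂ : S.T2M ≃ (FrechetT2.ProjSystem.cocycleCore hcover).TotalSpace :=
    FrechetT2.ProjSystem.fiberEquiv hcover fun x => FrechetT2.ProjSystem.accEquiv D (idx x) (hidx x)
  let h₁ : S.TMTM ≃ (FrechetT2.ProjSystem.cocycleCore hcover).TotalSpace :=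
    FrechetT2.ProjSystem.fiberEquiv hcover fun x =>
      (FrechetT2.ProjSystem.velEquiv (idx x) (hidx x)).prodCongr (FrechetT2.ProjSystem.velEquiv (idx x) (hidx x))
  let _ : TopologicalSpace S.T2M := TopologicalSpace.induced h₂ inferInstance
  let _ : TopologicalSpace S.TMTM := TopologicalSpace.induced h₁ inferInstance
  let H₂ : S.T2M ≃ₜ (FrechetT2.ProjSystem.cocycleCore hcover).TotalSpace := h₂.toHomeomorphOfIsInducing ⟨rfl⟩
  let H₁ : S.TMTM ≃ₜ (FrechetT2.ProjSystem.cocycleCore hcover).TotalSpace := h₁.toHomeomorphOfIsInducing ⟨rfl⟩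
  refine ⟨inferInstance, inferInstance, FrechetT2.ProjSystem.cocycleBundle H₂, FrechetT2.ProjSystem.cocycleBundle H₁,
    fun c => ⟨rfl, fun x hx f => ?_⟩, fun c => ⟨rfl, fun x hx f g => ?_⟩,
    ⟨FrechetT2.ProjSystem.cocycleBundleIso H₂ H₁⟩⟩
  -- The trivialization over `c` applies the cocycle to coordinates in the preferred chart; by the
  -- transformation law these become the coordinates in `c`, so the choice disappears.
  · have h : FrechetT2.ProjSystem.cocycleTriv H₂ c (FrechetT2.ProjSystem.T2M.mk f)
        = (x, (f.vel c, f.acc c + D.quad c hx (f.vel c))) :=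
      ((FrechetT2.ProjSystem.cocycleCore hcover).localTriv_apply c (H₂ (FrechetT2.ProjSystem.T2M.mk f))).trans
        (Prod.ext rfl (FrechetT2.ProjSystem.limOp_transCocycle_acc D (hidx x) hx f))
    exact ⟨congrArg Prod.fst h, congrArg (fun p => p.2.1) h,
      fun i => congrArg (fun p => p.2.2.1 i) h⟩
  · exact ((FrechetT2.ProjSystem.cocycleCore hcover).localTriv_apply c (H₁ (FrechetT2.ProjSystem.TMTM.mk f g))).trans
      (Prod.ext rfl (FrechetT2.ProjSystem.limOp_transCocycle_vel (hidx x) hx f g))
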